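/- Let $h>1$ and $\zeta_h(s)=\zeta(s+h)$, let $1<p\le 2$ and $\frac1p+\frac1{p'}=1$, and write $\mathbb{C}_+=\{s\in\mathbb{C}:\operatorname{Re}s>0\}$. Let $\mathcal{L}(g)(s)=\int_0^\infty e^{-st}g(t)\,dt$ be the Laplace transform, and let $H^p(\mathbb{C}_+)$ be the space of analytic functions $F$ on $\mathbb{C}_+$ with $\sup_{x>0}\int_{\mathbb{R}}|F(x+iy)|^p\,dy<\infty$. Write $\varphi=\mathcal{L}^{-1}(F)$ if $\varphi\in L^{p'}(0,\infty)$ and $\mathcal{L}(\varphi)=F$ on $\mathbb{C}_+$. For $r_0$ analytic on $\mathbb{C}_+$, a function $\varphi\in L^{p'}(0,\infty)$ is a solution of $\zeta_h(\partial_t)\varphi=J$ with generalized initial condition $r_0$ if $\zeta_h\mathcal{L}(\varphi)-r_0\in H^p(\mathbb{C}_+)$ and $\mathcal{L}^{-1}(\zeta_h\mathcal{L}(\varphi)-r_0)=J$. Let $J\in L^{p'}(0,\infty)$ with $\mathcal{L}(J)\in H^p(\mathbb{C}_+)$. Let $N\ge 0$, let $\omega_1,\dots,\omega_N$ be distinct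 complex numbers with $\operatorname{Re}\omega_i<0$, let $r_1,\dots,r_N$ be positive integers, and put $K=\sum_{i=1}^N r_i$. Assume that for some integer $M\ge K$ and for each $n=0,1,\dots,M$ there is $\sigma>0$ such that $y\mapsto y^n\mathcal{L}(J)(\sigma+iy)$ is in $L^1(\mathbb{R})$. Then for every $(\phi_0,\dots,\phi_{K-1})\in\mathbb{C}^K$ there exists an analytic function $r_0$ on $\mathbb{C}_+$ such that - $(\alpha)$ $r_0/\zeta_h\in H^p(\mathbb{C}_+)$, and $r_0/\zeta_h$ continues to a meromorphic function $Q$ on $\mathbb{C}$ which is analytic outside $\{\omega_1,\dots,\omega_N\}$ and has at each $\omega_i$ a pole of order at most $r_i$ (possibly a removable singularity); - $(\beta)$ $(\mathcal{L}(J)+r_0)/\zeta_h\in H^p(\mathbb{C}_+)$; - $(\gamma)$ there are $C$ and $q\ge 1$ such that $|Q(s)|\le C/|s|^q$ for all $s\in\mathbb{C}$ with $|s|$ sufficiently large; and such that the equation $\zeta_h(\partial_t)\varphi=J$ with generalized initial condition $r_0$ has a solution, which is unique in $L^{p'}(0,\infty)$, is given by $\varphi=\mathcal{L}^{-1}\big((\mathcal{L}(J)+r_0)/\zeta_h\big)$,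 is (after modification on a null set) of class $C^K$ on $[0,\infty)$, and satisfies $\varphi(0)=\phi_0,\ \dots,\ \varphi^{(K-1)}(0)=\phi_{K-1}$. The function $r_0$ is unique: if $r_1$ is analytic on $\mathbb{C}_+$ and satisfies $(\alpha)$, $(\beta)$, $(\gamma)$, and the corresponding equation has a continuous solution with the same initial values $\phi_0,\dots,\phi_{K-1}$, then $r_1=r_0$ on $\mathbb{C}_+$. Moreover, for generic initial values the orders of the poles are exactly the $r_i$: there are affine hyperplanes $A_1,\dots,A_N$ of $\mathbb{C}^K$ such that $Q$ has a pole of order exactly $r_i$ at $\omega_i$ if and only if $(\phi_0,\dots,\phi_{K-1})\notin A_i$. -/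

import Mathlib

open Set MeasureTheory
open scoped ENNReal

/-- The open right half-plane. -/
def rightHalfPlane : Set ℂ := {s : ℂ | 0 < s.re}

/-- The Laplace transform `∫₀^∞ e^{-st} g(t) dt`.  For `g ∈ L^q(0,∞)` with `1 ≤ q` the integral
converges absolutely at every `s` with `Re s > 0`; only such `s` are used. -/
noncomputable def laplace (g : ℝ → ℂ) (s : ℂ) : ℂ :=
  ∫ t in Ioi (0 : ℝ), Complex.exp (-s * (t : ℂ)) * g t

/-- Membership in `L^q(0,∞)`. -/
def MemLpHalfLine (q : ℝ) (g : ℝ → ℂ) : Prop :=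
  MemLp g (ENNReal.ofReal q) (volume.restrict (Ioi (0 : ℝ)))

/-- Membership in the Hardy space `H^q` of the right half-plane: `F` is analytic there and the
`L^q` norms over the vertical lines `Re s = x`, `x > 0`, are uniformly bounded (a normalising
factor `1/(2π)` does not change membership). -/
def MemHardy (q : ℝ) (F : ℂ → ℂ) : Prop :=
  AnalyticOnNhd ℂ F rightHalfPlane ∧
    ∃ C : ℝ≥0∞, C ≠ ⊤ ∧ ∀ x : ℝ, 0 < x →
      eLpNorm (fun y : ℝ => F ((x : ℂ) + (y : ℂ) * Complex.I)) (ENNReal.ofReal q) volume ≤ C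

/-- `g = 𝓛⁻¹(F)` in `L^q(0,∞)`: the function `g ∈ L^q(0,∞)`, unique up to null sets, whose
Laplace transform is `F` on the right half-plane. -/
def IsInvLaplace (q : ℝ) (F : ℂ → ℂ) (g : ℝ → ℂ) : Prop :=
  MemLpHalfLine q g ∧ EqOn (laplace g) F rightHalfPlane

/-- `φ ∈ L^{p'}(0,∞)` is a solution of `f(∂ₜ)φ = J` with generalized initial condition `r₀`:
`f 𝓛(φ) - r₀ ∈ H^p` and `𝓛⁻¹(f 𝓛(φ) - r₀) = J`. -/
structure IsSolution (p p' : ℝ) (f : ℂ → ℂ) (J : ℝ → ℂ) (r₀ : ℂ → ℂ) (φ : ℝ → ℂ) : Prop where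
  memLp : MemLpHalfLine p' φ
  memHardy : MemHardy p (fun s => f s * laplace φ s - r₀ s)
  eq_J : IsInvLaplace p' (fun s => f s * laplace φ s - r₀ s) J

/-- The shifted zeta function `ζ_h(s) = ζ(s + h)`. -/
noncomputable def zetaShift (h : ℝ) (s : ℂ) : ℂ := riemannZeta (s + (h : ℂ))

/-- `Q` is a meromorphic continuation to `ℂ` of the function `g`, given on the right half-plane,
and is analytic away from the points `ω i`. -/
structure IsMeroExt {N : ℕ} (ω : Fin N → ℂ) (g Q : ℂ → ℂ) : Prop where
  eqOn : EqOn Q g rightHalfPlane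
  analyticAt : ∀ s, s ∉ range ω → AnalyticAt ℂ Q s
  meromorphicAt : ∀ i, MeromorphicAt Q (ω i)

/-- The conditions on an analytic function `r₀` on the right half-plane:
`r₀ / f ∈ H^p`; `(𝓛(J) + r₀) / f ∈ H^p`; and `r₀ / f` continues to a meromorphic function on `ℂ`
whose only possible poles are the `ω i`, the order of the pole at `ω i` being at most `r i`,
and which is bounded by `C / |s|^q` for `|s|` large, for some `C` and some `q ≥ 1`. -/
structure IsGenInit (p : ℝ) (f : ℂ → ℂ) (J : ℝ → ℂ) {N : ℕ} (ω : Fin N → ℂ) (r : Fin N → ℕ)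
    (r₀ : ℂ → ℂ) : Prop where
  analytic : AnalyticOnNhd ℂ r₀ rightHalfPlane
  memHardy : MemHardy p (fun s => r₀ s / f s)
  memHardy_add : MemHardy p (fun s => (laplace J s + r₀ s) / f s)
  exists_ext : ∃ Q : ℂ → ℂ, IsMeroExt ω (fun s => r₀ s / f s) Q ∧
    (∀ i, ((-(r i : ℤ) : ℤ) : WithTop ℤ) ≤ meromorphicOrderAt Q (ω i)) ∧
    ∃ C q : ℝ, 1 ≤ q ∧ ∀ᶠ s in Bornology.cobounded ℂ, ‖Q s‖ ≤ C / ‖s‖ ^ q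

/-- The (one-sided) derivatives of `φ : [0,∞) → ℂ` at `0` of order `n < K` are `φ₀ n`. -/
def HasInitialValues {K : ℕ} (φ₀ : Fin K → ℂ) (φ : ℝ → ℂ) : Prop :=
  ∀ n : Fin K, iteratedDerivWithin (n : ℕ) φ (Ici (0 : ℝ)) 0 = φ₀ n

/-! Since `h > 1`, the function `ζ_h` has no zeros on `Re s > 0`, and `1/ζ_h = ∑ μ(n) n^{-h} n^{-s}`
is bounded there. Hence any solution satisfies `𝓛(φ) = 𝓛(J)/ζ_h + r₀/ζ_h`, and injectivity of `𝓛`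
gives uniqueness of `φ` for a given `r₀`. The two summands are inverted separately.

For the first, integrability of `y^M 𝓛(J)` on a vertical line and Fourier inversion make the zero
extension of `J` a `C^M` function on `ℝ`. Dividing by `ζ_h` means summing the delays `μ(n) n^{-h}
J(t - log n)`, a locally finite sum, so the result `f` is again `C^M` and zero for `t ≤ 0`. It
contributes nothing to the initial values (`exists_invLaplace_div_zetaShift`).

For the second, `Q` minus its principal parts is entire and tends to `0` at infinity, hence vanishes
by Liouville. So `r₀/ζ_h` is the Laplace transform of an exponential polynomial `∑ a_{ij} t^j e^{ω_i
t}` (`exists_eq_expPolyLaplace`), and conversely every coefficient vector `a` is admissible.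

The initial values of `φ` are thus a linear function of `a`, given by the `K × K` confluent
Vandermonde matrix. It is invertible (`expPolyInit_bijective`), so `φ₀` determines `a`, hence `r₀`.
The pole at `ω_i` has order `r_i` exactly when the top coefficient `a_{i, r_i - 1}` is nonzero,
which is a linear condition on `φ₀`. -/

/-! ### Confluent Vandermonde matrices -/

open Polynomial in
/-- The confluent Vandermonde matrix is left-injective. -/
theorem confluentVandermonde_vecMul_injective {N : ℕ} {ω : Fin N → ℂ}
    (hω : Function.Injective ω) (r : Fin N → ℕ) (c : Fin (∑ i, r i) → ℂ)
    (hc : ∀ i, ∀ j : Fin (r i),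
      ∑ n, c n * ((derivative^[(j : ℕ)] (X ^ (n : ℕ) : ℂ[X])).eval (ω i)) = 0) : c = 0 := by
  set q : ℂ[X] := ∑ n : Fin (∑ i, r i), C (c n) * X ^ (n : ℕ) with hq
  have hder : ∀ (j : ℕ) (z : ℂ), (derivative^[j] q).eval z =
      ∑ n, c n * ((derivative^[j] (X ^ (n : ℕ) : ℂ[X])).eval z) := by
    intro j z
    rw [hq, iterate_derivative_sum, eval_finsetSum]
    refine Finset.sum_congr rfl fun n _ => ?_
    rw [iterate_derivative_C_mul, eval_mul, eval_C]
  have hcoeff : ∀ n : Fin (∑ i, r i), q.coeff n = c n := by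
    intro n
    simp [hq, coeff_X_pow, Fin.val_inj]
  -- A nonzero `q` would be divisible by the pairwise coprime powers `(X - ω i)^(r i)`, so its
  -- degree would be at least `∑ r i`; it is smaller.
  have hq0 : q = 0 := by
    by_contra hne
    have hdvd : ∀ i, (X - C (ω i)) ^ r i ∣ q := by
      intro i
      rw [← le_rootMultiplicity_iff hne]
      rcases Nat.eq_zero_or_pos (r i) with h0 | hpos
      · simp [h0]
      · have := (lt_rootMultiplicity_iff_isRoot_iterate_derivative
          (p := q) (t := ω i) (n := r i - 1) hne).2 (fun m hm => by
            have := hc i ⟨m, by omega⟩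
            rw [IsRoot, hder]
            exact this)
        omega
    have hprod : (∏ i, (X - C (ω i)) ^ r i) ∣ q := by
      refine Finset.prod_dvd_of_coprime (fun i _ j _ hij => ?_) (fun i _ => hdvd i)
      exact (isCoprime_X_sub_C_of_isUnit_sub
        (sub_ne_zero.2 (hω.ne hij)).isUnit).pow
    have hdeg := natDegree_le_of_dvd hprod hne
    rw [natDegree_prod_of_monic _ _ (fun i _ => (monic_X_sub_C _).pow _)] at hdeg
    simp only [natDegree_pow, natDegree_X_sub_C, mul_one] at hdeg
    have hlt : q.degree < (∑ i, r i : ℕ) := by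
      rw [hq]
      refine lt_of_le_of_lt (degree_sum_le _ _) ?_
      rw [Finset.sup_lt_iff (by exact WithBot.bot_lt_coe _)]
      intro n _
      exact lt_of_le_of_lt (degree_C_mul_X_pow_le _ _) (by exact_mod_cast n.2)
    have := (natDegree_lt_iff_degree_lt hne).2 hlt
    omega
  funext n
  rw [← hcoeff n, hq0]; simp

/-! ### Exponential polynomials and their initial values -/

/-- The exponential polynomial with coefficients `a`. -/
noncomputable def expPoly {N : ℕ} (ω : Fin N → ℂ) {r : Fin N → ℕ}
    (a : (Σ i, Fin (r i)) → ℂ) (t : ℝ) : ℂ :=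
  ∑ x, a x * ((t : ℂ) ^ (x.2 : ℕ) * Complex.exp (ω x.1 * t))

open Polynomial in
/-- The initial values of the exponential polynomials, as a linear map of the coefficients. -/
noncomputable def expPolyInit {N : ℕ} (ω : Fin N → ℂ) (r : Fin N → ℕ) :
    ((Σ i, Fin (r i)) → ℂ) →ₗ[ℂ] (Fin (∑ i, r i) → ℂ) :=
  Matrix.mulVecLin (Matrix.of fun (n : Fin (∑ i, r i)) (x : Σ i, Fin (r i)) =>
    (derivative^[(x.2 : ℕ)] (X ^ (n : ℕ) : ℂ[X])).eval (ω x.1))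

theorem expPolyInit_surjective {N : ℕ} {ω : Fin N → ℂ} (hω : Function.Injective ω)
    (r : Fin N → ℕ) : Function.Surjective (expPolyInit ω r) := by
  set A : Matrix (Fin (∑ i, r i)) (Σ i, Fin (r i)) ℂ := Matrix.of fun n x =>
    (Polynomial.derivative^[(x.2 : ℕ)] (Polynomial.X ^ (n : ℕ))).eval (ω x.1) with hA
  -- Reindexing the columns makes the matrix square, so a trivial left kernel forces invertibility.
  set B := A.submatrix id (finSigmaFinEquiv (n := r)).symm with hB
  have hinj : Function.Injective B.vecMul := by
    intro c d hcd
    rw [← sub_eq_zero]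
    refine confluentVandermonde_vecMul_injective hω r _ fun i j => ?_
    have h1 : Matrix.vecMul (c - d) B = 0 := by
      rw [Matrix.sub_vecMul]; exact sub_eq_zero.2 hcd
    have h2 := congrFun h1 (finSigmaFinEquiv (n := r) ⟨i, j⟩)
    simpa [Matrix.vecMul, dotProduct, hB, hA] using h2
  have hsurj := Matrix.mulVec_surjective_iff_isUnit.2 (Matrix.vecMul_injective_iff_isUnit.1 hinj)
  intro φ
  obtain ⟨v, hv⟩ := hsurj φ
  refine ⟨v ∘ finSigmaFinEquiv, ?_⟩
  rw [← hv]
  funext n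
  change ∑ x, A n x * v (finSigmaFinEquiv x) = ∑ k, B n k * v k
  rw [← (finSigmaFinEquiv (n := r)).sum_comp]
  simp [hB]

theorem expPolyInit_bijective {N : ℕ} {ω : Fin N → ℂ} (hω : Function.Injective ω)
    (r : Fin N → ℕ) : Function.Bijective (expPolyInit ω r) := by
  refine ⟨(LinearMap.injective_iff_surjective_of_finrank_eq_finrank ?_).2
    (expPolyInit_surjective hω r), expPolyInit_surjective hω r⟩
  simp

theorem contDiff_pow_mul_exp (j : ℕ) (z : ℂ) {n : WithTop ℕ∞} :
    ContDiff ℝ n (fun t : ℝ => (t : ℂ) ^ j * Complex.exp (z * t)) := by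
  have : ContDiff ℝ n (fun t : ℝ => (t : ℂ)) := Complex.ofRealCLM.contDiff
  exact (this.pow j).mul (contDiff_const.mul this).cexp

theorem deriv_pow_mul_exp (j : ℕ) (z : ℂ) :
    deriv (fun t : ℝ => (t : ℂ) ^ j * Complex.exp (z * t)) =
      fun t : ℝ => j * ((t : ℂ) ^ (j - 1) * Complex.exp (z * t))
        + z * ((t : ℂ) ^ j * Complex.exp (z * t)) := by
  funext t
  have h1 : HasDerivAt (fun t : ℝ => (t : ℂ)) 1 t := Complex.ofRealCLM.hasDerivAt
  have h2 := (h1.pow j).mul (h1.const_mul z).cexp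
  rw [HasDerivAt.deriv (f := fun t : ℝ => (t : ℂ) ^ j * Complex.exp (z * t)) h2]
  simp only [Pi.pow_apply]
  ring

open Polynomial in
theorem iterate_derivative_X_mul_eq (j : ℕ) (p : ℂ[X]) :
    derivative^[j] (X * p) = (j : ℂ[X]) * derivative^[j - 1] p + X * derivative^[j] p := by
  induction j with
  | zero => simp
  | succ j ih =>
    rw [Function.iterate_succ_apply', ih]
    rcases j with _ | j
    · simp
    · simp [Function.iterate_succ_apply']
      ring

-- Formally, `t^j e^{zt} = ∂_z^j e^{zt}`, whose `n`-th `t`-derivative at `0` is `∂_z^j z^n`. In the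
-- induction on `n`, the product rule in `t` and Leibniz's rule for `∂_z^j (z · z^n)` give the same
-- recursion; the truncated `j - 1` at `j = 0` carries the factor `0`.
open Polynomial in
theorem iteratedDeriv_pow_mul_exp_zero (n j : ℕ) (z : ℂ) :
    iteratedDeriv n (fun t : ℝ => (t : ℂ) ^ j * Complex.exp (z * t)) 0 =
      (derivative^[j] (X ^ n : ℂ[X])).eval z := by
  induction n generalizing j with
  | zero =>
    rcases j with _ | j
    · simp
    · simp
  | succ n ih =>
    rw [iteratedDeriv_succ', deriv_pow_mul_exp, iteratedDeriv_fun_add, iteratedDeriv_const_mul_field,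
      iteratedDeriv_const_mul_field, ih, ih, pow_succ', iterate_derivative_X_mul_eq]
    · simp
    · exact (contDiff_const.mul (contDiff_pow_mul_exp _ _)).contDiffAt
    · exact (contDiff_const.mul (contDiff_pow_mul_exp _ _)).contDiffAt

theorem contDiff_expPoly {N : ℕ} (ω : Fin N → ℂ) {r : Fin N → ℕ}
    (a : (Σ i, Fin (r i)) → ℂ) {n : WithTop ℕ∞} : ContDiff ℝ n (expPoly ω a) := by
  unfold expPoly
  exact ContDiff.sum fun x _ => contDiff_const.mul (contDiff_pow_mul_exp _ _)

theorem iteratedDeriv_expPoly_zero {N : ℕ} (ω : Fin N → ℂ) {r : Fin N → ℕ}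
    (a : (Σ i, Fin (r i)) → ℂ) (n : Fin (∑ i, r i)) :
    iteratedDeriv n (expPoly ω a) 0 = expPolyInit ω r a n := by
  have : expPoly ω a = fun t : ℝ => ∑ x : (Σ i, Fin (r i)),
    a x * ((t : ℂ) ^ (x.2 : ℕ) * Complex.exp (ω x.1 * t)) := rfl
  rw [this, iteratedDeriv_fun_sum
    (fun x _ => (contDiff_const.mul (contDiff_pow_mul_exp _ _)).contDiffAt)]
  simp only [iteratedDeriv_const_mul_field, iteratedDeriv_pow_mul_exp_zero]
  simp only [expPolyInit, Matrix.mulVecLin_apply, Matrix.mulVec, dotProduct, Matrix.of_apply]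
  exact Finset.sum_congr rfl fun x _ => mul_comm _ _

/-! ### Laplace transforms of exponential polynomials -/

theorem norm_pow_mul_exp (j : ℕ) (z : ℂ) {t : ℝ} (ht : 0 < t) :
    ‖(t : ℂ) ^ j * Complex.exp (z * t)‖ = t ^ j * Real.exp (z.re * t) := by
  rw [norm_mul, norm_pow, Complex.norm_exp, Complex.norm_real, Real.norm_of_nonneg ht.le]
  simp

theorem continuous_pow_mul_exp (j : ℕ) (z : ℂ) :
    Continuous (fun t : ℝ => (t : ℂ) ^ j * Complex.exp (z * t)) :=
  (contDiff_pow_mul_exp j z (n := 0)).continuous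

theorem memLp_pow_mul_exp (j : ℕ) {z : ℂ} (hz : z.re < 0) {q : ℝ} (hq : 0 < q) :
    MemLpHalfLine q (fun t : ℝ => (t : ℂ) ^ j * Complex.exp (z * t)) := by
  have hq' : ENNReal.ofReal q ≠ 0 := by simpa using hq
  unfold MemLpHalfLine
  rw [← integrable_norm_rpow_iff (continuous_pow_mul_exp j z).aestronglyMeasurable hq'
    ENNReal.ofReal_ne_top, ENNReal.toReal_ofReal hq.le]
  have := integrableOn_rpow_mul_exp_neg_mul_rpow (p := 1) (s := j * q) (b := -z.re * q)
    (by have : 0 ≤ j * q := by positivity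
        linarith) one_pos (by nlinarith)
  refine this.congr_fun (fun t ht => ?_) measurableSet_Ioi
  simp only
  rw [norm_pow_mul_exp j z ht, Real.mul_rpow (pow_nonneg (le_of_lt ht) _) (Real.exp_nonneg _),
    ← Real.rpow_natCast, ← Real.rpow_mul (le_of_lt ht), ← Real.exp_mul, Real.rpow_one]
  congr 2; ring

theorem integrableOn_pow_mul_exp (j : ℕ) {z : ℂ} (hz : z.re < 0) :
    IntegrableOn (fun t : ℝ => (t : ℂ) ^ j * Complex.exp (z * t)) (Ioi 0) := by
  have := memLp_pow_mul_exp j hz one_pos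
  unfold MemLpHalfLine at this
  rwa [ENNReal.ofReal_one, memLp_one_iff_integrable] at this

theorem integral_pow_mul_exp (j : ℕ) {z : ℂ} (hz : z.re < 0) :
    ∫ t in Ioi (0 : ℝ), (t : ℂ) ^ j * Complex.exp (z * t) = (j.factorial : ℂ) / (-z) ^ (j + 1) := by
  have hz0 : z ≠ 0 := fun h => by simp [h] at hz
  -- The integral of the derivative of `t^i e^{zt}`. The boundary value `0 ^ i` is `1` only for `i =
  -- 0`, so this covers both the base case and the recursion.
  have key : ∀ i : ℕ, ∫ t in Ioi (0 : ℝ), (i * ((t : ℂ) ^ (i - 1) * Complex.exp (z * t))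
        + z * ((t : ℂ) ^ i * Complex.exp (z * t))) = 0 - (0 : ℂ) ^ i := by
    intro i
    have hlim : Filter.Tendsto (fun t : ℝ => (t : ℂ) ^ i * Complex.exp (z * t)) Filter.atTop
        (nhds 0) := by
      rw [tendsto_zero_iff_norm_tendsto_zero]
      have := Real.tendsto_pow_mul_exp_neg_atTop_nhds_zero i
      have h2 := (this.comp (Filter.tendsto_id.const_mul_atTop (neg_pos.2 hz))).const_mul
        ((-z.re)⁻¹ ^ i)
      rw [mul_zero] at h2
      refine h2.congr' ?_
      filter_upwards [Filter.eventually_gt_atTop 0] with t ht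
      rw [norm_pow_mul_exp i z ht]
      have : -z.re ≠ 0 := by linarith
      simp only [Function.comp, id, inv_pow, neg_mul, neg_neg]
      field_simp
      rw [← neg_mul, mul_pow]
    have := integral_Ioi_of_hasDerivAt_of_tendsto (a := 0) (m := 0)
      (f := fun t : ℝ => (t : ℂ) ^ i * Complex.exp (z * t))
      (f' := fun t : ℝ => i * ((t : ℂ) ^ (i - 1) * Complex.exp (z * t))
        + z * ((t : ℂ) ^ i * Complex.exp (z * t)))
      (continuous_pow_mul_exp i z).continuousWithinAt
      (fun t _ => by
        rw [← congrFun (deriv_pow_mul_exp i z) t]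
        exact ((contDiff_pow_mul_exp i z (n := 1)).differentiable one_ne_zero t).hasDerivAt)
      (((integrableOn_pow_mul_exp (i - 1) hz).const_mul _).add
        ((integrableOn_pow_mul_exp i hz).const_mul _)) hlim
    rw [this]; simp
  have key2 : ∀ i : ℕ, (i : ℂ) * (∫ t in Ioi (0 : ℝ), (t : ℂ) ^ (i - 1) * Complex.exp (z * t))
      + z * (∫ t in Ioi (0 : ℝ), (t : ℂ) ^ i * Complex.exp (z * t)) = - (0 : ℂ) ^ i := by
    intro i
    have h := key i
    rw [integral_add ((integrableOn_pow_mul_exp (i - 1) hz).const_mul _)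
      ((integrableOn_pow_mul_exp i hz).const_mul _), integral_const_mul, integral_const_mul] at h
    rw [h]; ring
  induction j with
  | zero =>
    have h := key2 0
    simp only [Nat.cast_zero, zero_mul, pow_zero, zero_add] at h
    simp only [pow_zero, zero_add, pow_one, Nat.factorial_zero, Nat.cast_one] at h ⊢
    rw [eq_div_iff (neg_ne_zero.2 hz0)]
    linear_combination -h
  | succ j ih =>
    have h := key2 (j + 1)
    rw [Nat.add_sub_cancel, ih] at h
    have hne : (-z) ^ (j + 1) ≠ 0 := pow_ne_zero _ (neg_ne_zero.2 hz0)
    rw [eq_div_iff (pow_ne_zero _ (neg_ne_zero.2 hz0)), Nat.factorial_succ]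
    push_cast at h ⊢
    rw [zero_pow (Nat.succ_ne_zero j)] at h
    field_simp at h
    rw [pow_succ (-z) (j + 1)]
    linear_combination -h

/-- The Laplace transform of the exponential polynomial with coefficients `a`. -/
noncomputable def expPolyLaplace {N : ℕ} (ω : Fin N → ℂ) {r : Fin N → ℕ}
    (a : (Σ i, Fin (r i)) → ℂ) (s : ℂ) : ℂ :=
  ∑ x, a x * (((x.2 : ℕ).factorial : ℂ) / (s - ω x.1) ^ ((x.2 : ℕ) + 1))

theorem laplace_expPoly {N : ℕ} {ω : Fin N → ℂ} (hω : ∀ i, (ω i).re < 0) {r : Fin N → ℕ}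
    (a : (Σ i, Fin (r i)) → ℂ) {s : ℂ} (hs : 0 < s.re) :
    laplace (expPoly ω a) s = expPolyLaplace ω a s := by
  have hre : ∀ x : (Σ i, Fin (r i)), (ω x.1 - s).re < 0 := fun x => by
    have := hω x.1
    simp; linarith
  have : ∀ t : ℝ, Complex.exp (-s * t) * expPoly ω a t =
      ∑ x : (Σ i, Fin (r i)), a x * ((t : ℂ) ^ (x.2 : ℕ) * Complex.exp ((ω x.1 - s) * t)) := by
    intro t
    rw [expPoly, Finset.mul_sum]
    refine Finset.sum_congr rfl fun x _ => ?_
    rw [show (ω x.1 - s) * t = -s * t + ω x.1 * t by ring, Complex.exp_add]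
    ring
  simp only [laplace, this]
  rw [integral_finsetSum _ fun x _ => (integrableOn_pow_mul_exp _ (hre x)).const_mul _]
  refine Finset.sum_congr rfl fun x _ => ?_
  rw [integral_const_mul, integral_pow_mul_exp _ (hre x), neg_sub]

theorem memLpHalfLine_expPoly {N : ℕ} {ω : Fin N → ℂ} (hω : ∀ i, (ω i).re < 0) {r : Fin N → ℕ}
    (a : (Σ i, Fin (r i)) → ℂ) {q : ℝ} (hq : 0 < q) : MemLpHalfLine q (expPoly ω a) := by
  unfold MemLpHalfLine expPoly
  exact memLp_finsetSum _ fun x _ => (memLp_pow_mul_exp _ (hω x.1) hq).const_mul _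

/-! ### Principal parts and Liouville's theorem -/

open Filter Topology in
/-- A function which has a removable singularity at every point agrees, off its singularities, with
an entire function. -/
theorem exists_differentiable_of_removable {E : ℂ → ℂ}
    (hE : ∀ s, ∃ g : ℂ → ℂ, AnalyticAt ℂ g s ∧ E =ᶠ[𝓝[≠] s] g) :
    ∃ G : ℂ → ℂ, Differentiable ℂ G ∧ ∀ s, ContinuousAt E s → G s = E s := by
  have hlim : ∀ (s : ℂ) (g : ℂ → ℂ), ContinuousAt g s → E =ᶠ[𝓝[≠] s] g →
      limUnder (𝓝[≠] s) E = g s := fun s g hg h =>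
    ((hg.tendsto.mono_left nhdsWithin_le_nhds).congr' h.symm).limUnder_eq
  -- Taking the punctured limit at every point, not only at singularities, makes the witness equal
  -- to the analytic `g` throughout a neighbourhood of `s`.
  refine ⟨fun s => limUnder (𝓝[≠] s) E, fun s => ?_, fun s hs => ?_⟩
  · obtain ⟨g, hg, hEg⟩ := hE s
    have h1 : ∀ᶠ z in 𝓝 s, limUnder (𝓝[≠] z) E = g z := by
      have h2 : ∀ᶠ z in 𝓝[≠] s, E =ᶠ[𝓝 z] g := by
        have := eventually_eventually_nhdsWithin.2 hEg
        filter_upwards [this, self_mem_nhdsWithin] with z hz hzs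
        rwa [isOpen_compl_singleton.nhdsWithin_eq hzs] at hz
      rw [eventually_nhdsWithin_iff] at h2
      filter_upwards [h2, hg.eventually_analyticAt] with z hz hgz
      rcases eq_or_ne z s with rfl | hne
      · exact hlim _ _ hgz.continuousAt hEg
      · exact hlim _ _ hgz.continuousAt ((hz hne).filter_mono nhdsWithin_le_nhds)
    exact (hg.congr (Filter.EventuallyEq.symm h1)).differentiableAt
  · exact hlim s E hs EventuallyEq.rfl

-- Since `G s = G w + (s - w) * dslope G w s`, dividing by `(s - w)^(m+1)` splits off the top polar
-- term and leaves the same problem for `dslope G w` with exponent `m`.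
open Filter Topology in
theorem exists_principalPart_of_div_pow {w : ℂ} (m : ℕ) {G : ℂ → ℂ} (hG : AnalyticAt ℂ G w) :
    ∃ (b : Fin m → ℂ) (g : ℂ → ℂ), AnalyticAt ℂ g w ∧
      ∀ s, s ≠ w → G s / (s - w) ^ m = ∑ j, b j / (s - w) ^ ((j : ℕ) + 1) + g s := by
  induction m generalizing G with
  | zero => exact ⟨0, G, hG, fun s _ => by simp⟩
  | succ m ih =>
    obtain ⟨p, hp⟩ := hG
    obtain ⟨b, g, hg, hb⟩ := ih (G := dslope G w) hp.has_fpower_series_dslope_fslope.analyticAt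
    refine ⟨Fin.snoc b (G w), g, hg, fun s hs => ?_⟩
    rw [Fin.sum_univ_castSucc]
    simp only [Fin.snoc_castSucc, Fin.snoc_last, Fin.val_castSucc, Fin.val_last]
    have hne : s - w ≠ 0 := sub_ne_zero.2 hs
    have h1 := hb s hs
    rw [add_right_comm, ← h1, dslope_of_ne _ hs, slope_def_field]
    field_simp
    ring

open Filter Topology in
/-- The principal part of a meromorphic function with a pole of order at most `m`. -/
theorem exists_principalPart {w : ℂ} {m : ℕ} {Q : ℂ → ℂ} (hQ : MeromorphicAt Q w)
    (hm : ((-(m : ℤ) : ℤ) : WithTop ℤ) ≤ meromorphicOrderAt Q w) :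
    ∃ (b : Fin m → ℂ) (g : ℂ → ℂ), AnalyticAt ℂ g w ∧
      ∀ᶠ s in 𝓝[≠] w, Q s = ∑ j, b j / (s - w) ^ ((j : ℕ) + 1) + g s := by
  have hpow : MeromorphicAt (fun s => (s - w) ^ m) w := by fun_prop
  have h0 : 0 ≤ meromorphicOrderAt (fun s => (s - w) ^ m * Q s) w := by
    rw [fun_meromorphicOrderAt_mul hpow hQ, fun_meromorphicOrderAt_pow_id_sub_const]
    calc (0 : WithTop ℤ) = (m : WithTop ℤ) + ((-(m : ℤ) : ℤ) : WithTop ℤ) := by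
          simp
      _ ≤ _ := by gcongr
  obtain ⟨G, hG, hGQ⟩ := (hpow.fun_mul hQ).meromorphicOrderAt_nonneg_iff.1 h0
  obtain ⟨b, g, hg, hb⟩ := exists_principalPart_of_div_pow m hG
  refine ⟨b, g, hg, ?_⟩
  filter_upwards [hGQ, self_mem_nhdsWithin] with s hs hsw
  rw [← hb s hsw, ← hs]
  have hne : s - w ≠ 0 := sub_ne_zero.2 hsw
  field_simp

theorem analyticAt_const_div_sub_pow (c : ℂ) {w s : ℂ} (h : s ≠ w) (m : ℕ) :
    AnalyticAt ℂ (fun s => c / (s - w) ^ m) s :=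
  analyticAt_const.div ((analyticAt_id.sub analyticAt_const).pow m)
    (pow_ne_zero _ (sub_ne_zero.2 h))

section expPolyLaplace

variable {N : ℕ} {ω : Fin N → ℂ} {r : Fin N → ℕ}

theorem analyticAt_expPolyLaplace (a : (Σ i, Fin (r i)) → ℂ) {s : ℂ} (hs : s ∉ range ω) :
    AnalyticAt ℂ (expPolyLaplace ω a) s := by
  unfold expPolyLaplace
  refine Finset.analyticAt_fun_sum _ fun x _ => analyticAt_const.mul ?_
  exact analyticAt_const_div_sub_pow _ (fun h => hs ⟨_, h.symm⟩) _

theorem expPolyLaplace_eq_principalPart_add (hω : Function.Injective ω)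
    (a : (Σ i, Fin (r i)) → ℂ) (i : Fin N) :
    ∃ g : ℂ → ℂ, AnalyticAt ℂ g (ω i) ∧ ∀ s, expPolyLaplace ω a s =
      ∑ j : Fin (r i), a ⟨i, j⟩ * (((j : ℕ).factorial : ℂ) / (s - ω i) ^ ((j : ℕ) + 1)) + g s := by
  refine ⟨fun s => ∑ k ∈ Finset.univ.erase i, ∑ j : Fin (r k), a ⟨k, j⟩ *
    (((j : ℕ).factorial : ℂ) / (s - ω k) ^ ((j : ℕ) + 1)), ?_, fun s => ?_⟩
  · refine Finset.analyticAt_fun_sum _ fun k hk => Finset.analyticAt_fun_sum _ fun j _ =>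
      analyticAt_const.mul (analyticAt_const_div_sub_pow _ (fun h => ?_) _)
    exact (Finset.ne_of_mem_erase hk) (hω h).symm
  · rw [expPolyLaplace, Fintype.sum_sigma]
    exact (Finset.add_sum_erase _ _ (Finset.mem_univ i)).symm

/-- Multiplying by `(s - ω i)^(r i)` clears the pole, and at `ω i` only the top term survives: `H (ω
i) = (r i - 1)! * a_{i, r i - 1}`. -/
theorem expPolyLaplace_eq_div (hω : Function.Injective ω) (a : (Σ i, Fin (r i)) → ℂ)
    (i : Fin N) (hr : 0 < r i) :
    ∃ H : ℂ → ℂ, AnalyticAt ℂ H (ω i) ∧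
      (H (ω i) = 0 ↔ a ⟨i, ⟨r i - 1, Nat.sub_lt hr one_pos⟩⟩ = 0) ∧
      ∀ s, s ≠ ω i → expPolyLaplace ω a s = (s - ω i) ^ (-(r i : ℤ)) * H s := by
  obtain ⟨g, hg, hgs⟩ := expPolyLaplace_eq_principalPart_add hω a i
  refine ⟨fun s => ∑ j : Fin (r i), a ⟨i, j⟩ * (((j : ℕ).factorial : ℂ) *
    (s - ω i) ^ (r i - 1 - (j : ℕ))) + (s - ω i) ^ r i * g s, ?_, ?_, fun s hs => ?_⟩
  · refine AnalyticAt.add (Finset.analyticAt_fun_sum _ fun j _ => ?_) (.mul ?_ hg) <;> fun_prop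
  · have hsum : ∑ j : Fin (r i), a ⟨i, j⟩ * (((j : ℕ).factorial : ℂ) *
        (ω i - ω i) ^ (r i - 1 - (j : ℕ))) =
        a ⟨i, ⟨r i - 1, Nat.sub_lt hr one_pos⟩⟩ * ((r i - 1).factorial : ℂ) := by
      rw [Finset.sum_eq_single_of_mem ⟨r i - 1, Nat.sub_lt hr one_pos⟩ (Finset.mem_univ _)]
      · simp
      · intro j _ hj
        have h1 : (j : ℕ) ≠ r i - 1 := fun h => hj (Fin.ext h)
        have h2 : r i - 1 - (j : ℕ) ≠ 0 := by have := j.2; omega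
        simp [h2]
    simp only [hsum]
    simp [hr.ne', Nat.factorial_ne_zero]
  · have hne : s - ω i ≠ 0 := sub_ne_zero.2 hs
    rw [hgs, mul_add, Finset.mul_sum]
    congr 1
    · refine Finset.sum_congr rfl fun j _ => ?_
      rw [zpow_neg, zpow_natCast]
      have h3 : r i = (r i - 1 - (j : ℕ)) + ((j : ℕ) + 1) := by have := j.2; omega
      have h4 : (s - ω i) ^ r i = (s - ω i) ^ (r i - 1 - (j : ℕ)) * (s - ω i) ^ ((j : ℕ) + 1) := by
        rw [← pow_add, ← h3]
      rw [h4]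
      field_simp
    · rw [zpow_neg, zpow_natCast]
      field_simp

theorem meromorphicAt_expPolyLaplace (a : (Σ i, Fin (r i)) → ℂ) (s : ℂ) :
    MeromorphicAt (expPolyLaplace ω a) s := by
  unfold expPolyLaplace
  fun_prop

theorem le_meromorphicOrderAt_expPolyLaplace (hω : Function.Injective ω)
    (a : (Σ i, Fin (r i)) → ℂ) (i : Fin N) (hr : 0 < r i) :
    ((-(r i : ℤ) : ℤ) : WithTop ℤ) ≤ meromorphicOrderAt (expPolyLaplace ω a) (ω i) ∧
      (meromorphicOrderAt (expPolyLaplace ω a) (ω i) = ((-(r i : ℤ) : ℤ) : WithTop ℤ) ↔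
        a ⟨i, ⟨r i - 1, Nat.sub_lt hr one_pos⟩⟩ ≠ 0) := by
  obtain ⟨H, hH, hH0, hs⟩ := expPolyLaplace_eq_div hω a i hr
  have h1 : meromorphicOrderAt (expPolyLaplace ω a) (ω i) =
      ((-(r i : ℤ) : ℤ) : WithTop ℤ) + meromorphicOrderAt H (ω i) := by
    rw [meromorphicOrderAt_congr (f₂ := fun s => (s - ω i) ^ (-(r i : ℤ)) * H s)
      (by filter_upwards [self_mem_nhdsWithin] with s h using hs s h),
      fun_meromorphicOrderAt_mul (by fun_prop) hH.meromorphicAt,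
      fun_meromorphicOrderAt_zpow_id_sub_const]
  have h2 := hH.meromorphicOrderAt_nonneg
  rw [h1]
  refine ⟨le_add_of_nonneg_right h2, ?_⟩
  rw [ne_eq, ← hH0]
  have h3 : meromorphicOrderAt H (ω i) = 0 ↔ ¬ H (ω i) = 0 := by
    rw [← ne_eq, ← hH.analyticOrderAt_eq_zero, hH.meromorphicOrderAt_eq]
    cases analyticOrderAt H (ω i) <;> simp
  rw [← h3]
  -- Cancelling `-r i` in `WithTop ℤ` needs a finite order, so `H` vanishing identically near `ω i`
  -- is treated apart.
  cases h : meromorphicOrderAt H (ω i) with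
  | top => exact ⟨fun h => absurd h (by rw [WithTop.add_top]; exact WithTop.top_ne_coe),
      fun h => absurd h (by simp)⟩
  | coe n => norm_cast; simp

open Filter in
theorem exists_norm_expPolyLaplace_le (ω : Fin N → ℂ) (a : (Σ i, Fin (r i)) → ℂ) :
    ∃ C : ℝ, ∀ᶠ s in Bornology.cobounded ℂ, ‖expPolyLaplace ω a s‖ ≤ C / ‖s‖ := by
  refine ⟨∑ x : (Σ i, Fin (r i)), ‖a x‖ * ((x.2 : ℕ).factorial * 2 ^ ((x.2 : ℕ) + 1)), ?_⟩
  have h1 : ∀ᶠ s in Bornology.cobounded ℂ, ∀ i, 2 * ‖ω i‖ + 1 ≤ ‖s‖ :=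
    eventually_all.2 fun i => tendsto_norm_cobounded_atTop.eventually_ge_atTop _
  filter_upwards [h1, tendsto_norm_cobounded_atTop.eventually_ge_atTop 1] with s hs hs1
  rw [expPolyLaplace, Finset.sum_div]
  refine (norm_sum_le _ _).trans (Finset.sum_le_sum fun x _ => ?_)
  rw [norm_mul, norm_div, norm_pow, Complex.norm_natCast, mul_div_assoc, mul_div_assoc]
  gcongr
  rw [div_eq_mul_inv]
  gcongr
  have h2 : ‖s‖ / 2 ≤ ‖s - ω x.1‖ := by
    have := norm_sub_norm_le s (ω x.1)
    have := hs x.1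
    linarith
  have h3 : 0 < ‖s - ω x.1‖ := lt_of_lt_of_le (by linarith) h2
  rw [inv_le_comm₀ (by positivity) (by positivity), inv_div]
  calc ‖s‖ / 2 ^ ((x.2 : ℕ) + 1) ≤ ‖s‖ ^ ((x.2 : ℕ) + 1) / 2 ^ ((x.2 : ℕ) + 1) := by
        gcongr
        exact le_self_pow₀ hs1 (by omega)
    _ = (‖s‖ / 2) ^ ((x.2 : ℕ) + 1) := by rw [div_pow]
    _ ≤ _ := by gcongr

/-- A meromorphic function vanishing at infinity, with poles only at the `ω i` and of order at most
`r i`, is the Laplace transform of an exponential polynomial. -/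
theorem exists_eq_expPolyLaplace (hω : Function.Injective ω) {Q : ℂ → ℂ}
    (hQ : ∀ s, s ∉ range ω → AnalyticAt ℂ Q s) (hQω : ∀ i, MeromorphicAt Q (ω i))
    (hord : ∀ i, ((-(r i : ℤ) : ℤ) : WithTop ℤ) ≤ meromorphicOrderAt Q (ω i))
    (hlim : Filter.Tendsto Q (Bornology.cobounded ℂ) (nhds 0)) :
    ∃ a : (Σ i, Fin (r i)) → ℂ, ∀ s, s ∉ range ω → Q s = expPolyLaplace ω a s := by
  choose b g hg hb using fun i => exists_principalPart (hQω i) (hord i)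
  -- The division compensates the `j!` in the transform of `t^j e^{ωt}`, so subtracting
  -- `expPolyLaplace ω a` cancels every principal part of `Q`.
  set a : (Σ i, Fin (r i)) → ℂ := fun x => b x.1 x.2 / ((x.2 : ℕ).factorial : ℂ) with ha
  refine ⟨a, ?_⟩
  obtain ⟨G, hG, hGE⟩ := exists_differentiable_of_removable
    (E := fun s => Q s - expPolyLaplace ω a s) (fun s => by
      by_cases hs : s ∈ range ω
      · obtain ⟨i, rfl⟩ := hs
        obtain ⟨g', hg', hgs⟩ := expPolyLaplace_eq_principalPart_add hω a i
        refine ⟨fun s => g i s - g' s, (hg i).sub hg', ?_⟩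
        filter_upwards [hb i] with s h
        rw [h, hgs]
        have : ∀ j : Fin (r i), a ⟨i, j⟩ * (((j : ℕ).factorial : ℂ) / (s - ω i) ^ ((j : ℕ) + 1)) =
            b i j / (s - ω i) ^ ((j : ℕ) + 1) := fun j => by
          have := Nat.cast_ne_zero (R := ℂ).2 (Nat.factorial_ne_zero (j : ℕ))
          simp only [ha]
          field_simp
        simp only [this]
        ring
      · exact ⟨_, (hQ s hs).sub (analyticAt_expPolyLaplace a hs), Filter.EventuallyEq.rfl⟩)
  have hEq : ∀ s, s ∉ range ω → G s = Q s - expPolyLaplace ω a s := fun s hs =>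
    hGE s ((hQ s hs).sub (analyticAt_expPolyLaplace a hs)).continuousAt
  have hlim2 : Filter.Tendsto (expPolyLaplace ω a) (Bornology.cobounded ℂ) (nhds 0) := by
    obtain ⟨C, hC⟩ := exists_norm_expPolyLaplace_le ω a
    refine squeeze_zero_norm' hC ?_
    exact tendsto_norm_cobounded_atTop.const_div_atTop C
  have hG0 : Filter.Tendsto G (Filter.cocompact ℂ) (nhds 0) := by
    rw [← Metric.cobounded_eq_cocompact]
    have := hlim.sub hlim2
    rw [sub_zero] at this
    refine this.congr' ?_
    have hfin : (range ω)ᶜ ∈ Bornology.cobounded ℂ := (finite_range ω).isBounded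
    filter_upwards [hfin] with s hs using (hEq s hs).symm
  intro s hs
  have := hEq s hs
  rw [hG.apply_eq_of_tendsto_cocompact s hG0] at this
  exact (sub_eq_zero.1 this.symm)

end expPolyLaplace

/-! ### Uniqueness of the meromorphic continuation -/

theorem isOpen_rightHalfPlane : IsOpen rightHalfPlane :=
  isOpen_lt continuous_const Complex.continuous_re

/-- Two meromorphic continuations agree off the possible poles. -/
theorem IsMeroExt.eqOn_compl {N : ℕ} {ω : Fin N → ℂ} (hω : ∀ i, (ω i).re < 0) {g Q R : ℂ → ℂ}
    (hQ : IsMeroExt ω g Q) (hR : IsMeroExt ω g R) : EqOn Q R (range ω)ᶜ := by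
  have hconn : IsPreconnected (range ω)ᶜ :=
    ((finite_range ω).countable.isPathConnected_compl_of_one_lt_rank
      (by rw [Complex.rank_real_complex]; exact Nat.one_lt_ofNat)).isConnected.isPreconnected
  have h1 : (1 : ℂ) ∈ (range ω)ᶜ := by
    rintro ⟨i, hi⟩
    have := hω i
    rw [hi] at this
    norm_num at this
  refine AnalyticOnNhd.eqOn_of_preconnected_of_eventuallyEq (fun s hs => hQ.analyticAt s hs)
    (fun s hs => hR.analyticAt s hs) hconn h1 ?_
  filter_upwards [isOpen_rightHalfPlane.mem_nhds (show (1 : ℂ) ∈ rightHalfPlane by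
    simp [rightHalfPlane])] with s hs
  rw [hQ.eqOn hs, hR.eqOn hs]

/-- The order only sees a punctured neighbourhood, which can be chosen to avoid the other finitely
many `ω i`. Pole orders therefore do not depend on the continuation chosen. -/
theorem IsMeroExt.meromorphicOrderAt_eq {N : ℕ} {ω : Fin N → ℂ} (hω : ∀ i, (ω i).re < 0)
    {g Q R : ℂ → ℂ} (hQ : IsMeroExt ω g Q) (hR : IsMeroExt ω g R) (z : ℂ) :
    meromorphicOrderAt Q z = meromorphicOrderAt R z := by
  refine meromorphicOrderAt_congr ?_
  have hfin : (range ω \ {z})ᶜ ∈ nhds z :=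
    ((finite_range ω).subset sdiff_subset).isClosed.isOpen_compl.mem_nhds (by simp)
  filter_upwards [nhdsWithin_le_nhds hfin, self_mem_nhdsWithin] with s hs hsz
  exact hQ.eqOn_compl hω hR fun h => hs ⟨h, hsz⟩

/-! ### Fourier inversion and the Laplace transform on vertical lines -/

open Filter Topology FourierTransform in
/-- The Fourier inversion formula for an integrable function with integrable Fourier transform. -/
theorem ae_eq_fourierInv_fourier {f : ℝ → ℂ} (hf : Integrable f) (hf' : Integrable (𝓕 f)) :
    f =ᵐ[volume] 𝓕⁻ (𝓕 f) := by
  have hcont : Continuous (𝓕⁻ (𝓕 f)) := by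
    rw [Real.fourierInv_eq_fourier_comp_neg]
    exact VectorFourier.fourierIntegral_continuous Real.continuous_fourierChar
      continuous_inner hf'.comp_neg
  -- Continuity of `f` is not available, so equality is tested against smooth compactly supported
  -- `g`. Writing `g` as the transform of a Schwartz function `H`, two uses of `∫ û v = ∫ u v̂` move
  -- the transforms across.
  refine ae_eq_of_integral_contDiff_smul_eq hf.locallyIntegrable hcont.locallyIntegrable
    fun g hg hgc => ?_
  have hg1 : HasCompactSupport (Complex.ofRealCLM ∘ g) := hgc.comp_left rfl
  have hg2 : ContDiff ℝ ((⊤ : ℕ∞) : WithTop ℕ∞) (Complex.ofRealCLM ∘ g) :=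
    Complex.ofRealCLM.contDiff.comp hg
  set G : SchwartzMap ℝ ℂ := hg1.toSchwartzMap hg2 with hG
  have hGg : ∀ x, G x = (g x : ℂ) := fun x => rfl
  set H : SchwartzMap ℝ ℂ := 𝓕⁻ G with hH
  have hHG : 𝓕 (H : ℝ → ℂ) = G := by
    rw [← SchwartzMap.fourier_coe, hH]
    simp
  have hHG' : (H : ℝ → ℂ) = 𝓕⁻ (G : ℝ → ℂ) := by
    rw [hH, SchwartzMap.fourierInv_coe]
  have h1 : ∫ x, (𝓕 (H : ℝ → ℂ)) x • f x = ∫ x, H x • 𝓕 f x := by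
    simpa using! (VectorFourier.integral_fourierIntegral_smul_eq_flip (L := innerₗ ℝ)
      Real.continuous_fourierChar continuous_inner H.integrable hf)
  have h2 : ∫ x, (𝓕 (𝓕 f)) x • G (-x) = ∫ x, 𝓕 f x • (𝓕 (fun x => G (-x))) x := by
    simpa using! (VectorFourier.integral_fourierIntegral_smul_eq_flip (L := innerₗ ℝ)
      Real.continuous_fourierChar continuous_inner hf' G.integrable.comp_neg)
  rw [← Real.fourierInv_eq_fourier_comp_neg, ← hHG'] at h2
  rw [hHG] at h1
  calc ∫ x, g x • f x = ∫ x, G x • f x := by simp [hGg, Complex.real_smul]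
    _ = ∫ x, 𝓕 f x • H x := by
        rw [h1]
        exact integral_congr_ae (.of_forall fun x => mul_comm _ _)
    _ = ∫ x, (fun x => (𝓕 (𝓕 f)) x • G (-x)) (-x) := by
        rw [← h2]
        exact (integral_neg_eq_self (fun x => (𝓕 (𝓕 f)) x • G (-x)) volume).symm
    _ = ∫ x, g x • 𝓕⁻ (𝓕 f) x := by
        refine integral_congr_ae (.of_forall fun x => ?_)
        simp only [neg_neg, hGg, Real.fourierInv_eq_fourier_neg, smul_eq_mul, Complex.real_smul]
        exact mul_comm _ _

/-- The function `t ↦ e^{-σt} g(t)` on the half-line, extended by zero. -/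
noncomputable def dampedExt (σ : ℝ) (g : ℝ → ℂ) : ℝ → ℂ :=
  indicator (Ioi 0) fun t => Complex.exp (-(σ : ℂ) * t) * g t

theorem MemLpHalfLine.integrableOn_exp_mul {p p' : ℝ} (hpp' : p.HolderConjugate p')
    {g : ℝ → ℂ} (hg : MemLpHalfLine p' g) {s : ℂ} (hs : 0 < s.re) :
    IntegrableOn (fun t : ℝ => Complex.exp (-s * t) * g t) (Ioi 0) := by
  have h1 := memLp_pow_mul_exp 0 (z := -s) (by simpa using hs) hpp'.pos
  have := hpp'.ennrealOfReal
  simpa using! MemLp.integrable_mul h1 hg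

open FourierTransform in
theorem fourier_dampedExt (σ : ℝ) (g : ℝ → ℂ) (ξ : ℝ) :
    𝓕 (dampedExt σ g) ξ = laplace g ((σ : ℂ) + ((2 * Real.pi * ξ : ℝ) : ℂ) * Complex.I) := by
  rw [Real.fourier_real_eq_integral_exp_smul, laplace, ← integral_indicator measurableSet_Ioi]
  refine integral_congr_ae (.of_forall fun t => ?_)
  by_cases ht : t ∈ Ioi (0 : ℝ)
  · simp only [dampedExt, indicator_of_mem ht, smul_eq_mul]
    rw [← mul_assoc, ← Complex.exp_add]
    congr 2
    push_cast
    ring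
  · simp [dampedExt, indicator_of_notMem ht]

theorem MemLpHalfLine.integrable_dampedExt {p p' : ℝ} (hpp' : p.HolderConjugate p')
    {g : ℝ → ℂ} (hg : MemLpHalfLine p' g) {σ : ℝ} (hσ : 0 < σ) : Integrable (dampedExt σ g) :=
  (hg.integrableOn_exp_mul hpp' (s := σ) (by simpa using hσ)).integrable_indicator measurableSet_Ioi

open FourierTransform in
/-- Injectivity of the Laplace transform. -/
theorem ae_eq_of_laplace_eqOn {p p' : ℝ} (hpp' : p.HolderConjugate p') {f g : ℝ → ℂ}
    (hf : MemLpHalfLine p' f) (hg : MemLpHalfLine p' g)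
    (h : EqOn (laplace f) (laplace g) rightHalfPlane) :
    f =ᵐ[volume.restrict (Ioi (0 : ℝ))] g := by
  -- The single line `Re s = 1` already determines the function.
  have hfi := hf.integrable_dampedExt hpp' one_pos
  have hgi := hg.integrable_dampedExt hpp' one_pos
  set k : ℝ → ℂ := dampedExt 1 f - dampedExt 1 g with hk
  have hF : 𝓕 k = 0 := by
    funext ξ
    have : 𝓕 k ξ = 𝓕 (dampedExt 1 f) ξ - 𝓕 (dampedExt 1 g) ξ := by
      simp only [Real.fourier_eq]
      rw [← integral_sub ((Real.fourierIntegral_convergent_iff ξ).2 hfi)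
        ((Real.fourierIntegral_convergent_iff ξ).2 hgi)]
      simp [hk, smul_sub]
    rw [this, fourier_dampedExt, fourier_dampedExt, h (by simp [rightHalfPlane])]
    simp
  have h0 := ae_eq_fourierInv_fourier (hfi.sub hgi) (by rw [← hk, hF]; exact integrable_zero _ _ _)
  rw [← hk, hF] at h0
  filter_upwards [ae_restrict_of_ae h0, ae_restrict_mem measurableSet_Ioi] with t ht hpos
  have h1 : 𝓕⁻ (0 : ℝ → ℂ) t = 0 := by simp [Real.fourierInv_eq]
  rw [h1, hk, Pi.sub_apply, dampedExt, dampedExt, indicator_of_mem hpos, indicator_of_mem hpos,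
    ← mul_sub] at ht
  exact sub_eq_zero.1 ((mul_eq_zero.1 ht).resolve_left (Complex.exp_ne_zero _))

open FourierTransform in
/-- A function on the half-line whose Laplace transform is integrable on a vertical line against
`y ^ M` extends by zero to a function of class `C ^ M`. -/
theorem exists_contDiff_of_integrable_laplace {p p' : ℝ} (hpp' : p.HolderConjugate p')
    {J : ℝ → ℂ} (hJ : MemLpHalfLine p' J) {M : ℕ} {σ : ℝ} (hσ : 0 < σ)
    (hH : ∀ n ≤ M, Integrable
      (fun y : ℝ => (y : ℂ) ^ n * laplace J ((σ : ℂ) + (y : ℂ) * Complex.I))) :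
    ∃ J' : ℝ → ℂ, ContDiff ℝ M J' ∧ (∀ t ≤ 0, J' t = 0) ∧
      J' =ᵐ[volume.restrict (Ioi (0 : ℝ))] J := by
  have hi := hJ.integrable_dampedExt hpp' hσ
  have hpi : (2 * Real.pi : ℝ) ≠ 0 := by positivity
  have hFn : ∀ n ≤ M, Integrable fun ξ : ℝ => ‖ξ‖ ^ n * ‖𝓕 (dampedExt σ J) ξ‖ := by
    intro n hn
    have h1 := (((hH n hn).comp_mul_left' hpi).norm.const_mul ((2 * Real.pi)⁻¹ ^ n))
    refine h1.congr (.of_forall fun ξ => ?_)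
    simp only [fourier_dampedExt, norm_mul, norm_pow, Complex.norm_real]
    rw [Real.norm_of_nonneg (by positivity : (0 : ℝ) ≤ 2), Real.norm_of_nonneg Real.pi_pos.le,
      ← mul_assoc, ← mul_pow, ← mul_assoc, inv_mul_cancel₀ hpi, one_mul]
  have hcontF : Continuous (𝓕 (dampedExt σ J)) :=
    VectorFourier.fourierIntegral_continuous Real.continuous_fourierChar continuous_inner hi
  have hF : Integrable (𝓕 (dampedExt σ J)) := by
    have := hFn 0 (Nat.zero_le _)
    simp only [pow_zero, one_mul] at this
    exact (integrable_norm_iff hcontF.aestronglyMeasurable).1 this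
  set G : ℝ → ℂ := 𝓕⁻ (𝓕 (dampedExt σ J)) with hG
  have hGeq : dampedExt σ J =ᵐ[volume] G := ae_eq_fourierInv_fourier hi hF
  have hGcd : ContDiff ℝ M G := by
    have h2 : ContDiff ℝ ((M : ℕ∞) : WithTop ℕ∞) (𝓕 (𝓕 (dampedExt σ J))) :=
      Real.contDiff_fourier fun n hn => hFn n (by exact_mod_cast hn)
    have h3 : G = fun t => 𝓕 (𝓕 (dampedExt σ J)) (-t) := by
      funext t; rw [hG, Real.fourierInv_eq_fourier_neg]
    rw [h3]
    exact h2.comp contDiff_neg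
  -- Being continuous and a.e. zero on the left, `G` is zero at every `t ≤ 0`; multiplying by
  -- `e^{σt}` below undoes the damping.
  have hG0 : EqOn G 0 (Iic 0) := by
    refine Measure.eqOn_of_ae_eq (μ := volume) ?_ hGcd.continuous.continuousOn
      continuousOn_const (by rw [interior_Iic, closure_Iio])
    filter_upwards [ae_restrict_of_ae hGeq, ae_restrict_mem measurableSet_Iic] with t ht ht0
    rw [← ht, dampedExt, indicator_of_notMem (by simpa using ht0)]
    rfl
  refine ⟨fun t => Complex.exp (σ * t) * G t, ?_, fun t ht => ?_, ?_⟩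
  · have := contDiff_pow_mul_exp 0 (σ : ℂ) (n := (M : WithTop ℕ∞))
    simp only [pow_zero, one_mul] at this
    exact this.mul hGcd
  · have : G t = 0 := hG0 ht
    simp [this]
  · filter_upwards [ae_restrict_of_ae hGeq, ae_restrict_mem measurableSet_Ioi] with t ht ht0
    rw [← ht, dampedExt, indicator_of_mem ht0, ← mul_assoc, ← Complex.exp_add]
    simp

/-! ### Dirichlet series acting by logarithmic delays -/

/-- The Dirichlet series `∑ c n n^{-s}`, in the variable `s = ∂ₜ`, applied to `g`. -/
noncomputable def logShiftSum (c : ℕ → ℂ) (g : ℝ → ℂ) (t : ℝ) : ℂ :=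
  ∑' n : ℕ, c n * g (t - Real.log n)

section logShiftSum

variable {c : ℕ → ℂ} {g : ℝ → ℂ}

/-- All shifts are delays: `log n ≥ 0` for every natural `n`, including `n = 0`, where `Real.log 0 =
0`. -/
theorem logShiftSum_of_nonpos (hg : ∀ t ≤ 0, g t = 0) {t : ℝ} (ht : t ≤ 0) :
    logShiftSum c g t = 0 := by
  have : ∀ n : ℕ, c n * g (t - Real.log n) = 0 := fun n => by
    rw [hg _ (by linarith [Real.log_natCast_nonneg n]), mul_zero]
  simp [logShiftSum, this]

/-- Terms with `n ≥ B` are delayed beyond `t`. The series is thus locally finite, and smoothness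
passes to it from finite sums. -/
theorem logShiftSum_eq_sum (hg : ∀ t ≤ 0, g t = 0) {B : ℕ} (hB : 0 < B) {t : ℝ}
    (ht : t < Real.log B) :
    logShiftSum c g t = ∑ n ∈ Finset.range B, c n * g (t - Real.log n) := by
  refine tsum_eq_sum fun n hn => ?_
  have h1 : (B : ℝ) ≤ n := by exact_mod_cast not_lt.1 fun h => hn (Finset.mem_range.2 h)
  have h2 := Real.log_le_log (by exact_mod_cast hB) h1
  rw [hg _ (by linarith), mul_zero]

open Filter in
theorem eventually_lt_log_natCast (t : ℝ) : ∀ᶠ B : ℕ in atTop, 0 < B ∧ t < Real.log B :=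
  (eventually_gt_atTop 0).and
    ((Real.tendsto_log_atTop.comp tendsto_natCast_atTop_atTop).eventually_gt_atTop t)

theorem contDiff_logShiftSum (hg : ∀ t ≤ 0, g t = 0) {M : WithTop ℕ∞} (hgc : ContDiff ℝ M g) :
    ContDiff ℝ M (logShiftSum c g) := by
  rw [contDiff_iff_contDiffAt]
  intro t
  obtain ⟨B, hB, htB⟩ := (eventually_lt_log_natCast t).exists
  have h1 : ContDiff ℝ M fun t => ∑ n ∈ Finset.range B, c n * g (t - Real.log n) :=
    ContDiff.sum fun n _ => contDiff_const.mul (hgc.comp (contDiff_id.sub contDiff_const))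
  refine h1.contDiffAt.congr_of_eventuallyEq ?_
  filter_upwards [Iio_mem_nhds htB] with x hx using logShiftSum_eq_sum hg hB hx

-- Translations preserve the `L^q` norm, so Minkowski bounds all partial sums by `(∑ ‖c n‖) ‖g‖_q`;
-- at each point they are eventually constant, and Fatou concludes.
open Filter in
theorem memLp_logShiftSum (hc : Summable fun n => ‖c n‖) (hg : ∀ t ≤ 0, g t = 0)
    (hgc : Continuous g) {q : ℝ≥0∞} (hq : 1 ≤ q) (hgq : MemLp g q) :
    MemLp (logShiftSum c g) q := by
  have hm : ∀ n : ℕ, MemLp (fun t => g (t - Real.log n)) q := fun n =>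
    hgq.comp_measurePreserving (measurePreserving_sub_right volume (Real.log n))
  have hmn : ∀ n : ℕ, eLpNorm (fun t => g (t - Real.log n)) q = eLpNorm g q := fun n =>
    eLpNorm_comp_measurePreserving hgq.1 (measurePreserving_sub_right volume (Real.log n))
  have hbound : ∀ B : ℕ, eLpNorm (fun t => ∑ n ∈ Finset.range B, c n * g (t - Real.log n)) q volume
      ≤ ENNReal.ofReal (∑' n, ‖c n‖) * eLpNorm g q := by
    intro B
    have h1 : (fun t => ∑ n ∈ Finset.range B, c n * g (t - Real.log n)) =
        ∑ n ∈ Finset.range B, c n • fun t => g (t - Real.log n) := by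
      funext t; simp
    rw [h1]
    refine (eLpNorm_sum_le (fun n _ => ((hm n).const_smul (c n)).1) hq).trans ?_
    calc ∑ n ∈ Finset.range B, eLpNorm (c n • fun t => g (t - Real.log n)) q volume
        = ENNReal.ofReal (∑ n ∈ Finset.range B, ‖c n‖) * eLpNorm g q := by
          rw [ENNReal.ofReal_sum_of_nonneg fun n _ => norm_nonneg _, Finset.sum_mul]
          refine Finset.sum_congr rfl fun n _ => ?_
          rw [eLpNorm_const_smul, hmn, ofReal_norm]
      _ ≤ _ := by
          gcongr
          exact hc.sum_le_tsum _ fun n _ => norm_nonneg _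
  refine ⟨(contDiff_logShiftSum hg (M := 0) (contDiff_zero.2 hgc)).continuous.aestronglyMeasurable,
    ?_⟩
  have hlim : ∀ᵐ t, Tendsto (fun B : ℕ => ∑ n ∈ Finset.range B, c n * g (t - Real.log n)) atTop
      (nhds (logShiftSum c g t)) := .of_forall fun t => by
    refine tendsto_const_nhds.congr' ?_
    filter_upwards [eventually_lt_log_natCast t] with B hB using logShiftSum_eq_sum hg hB.1 hB.2
  have hSm : ∀ B : ℕ, AEStronglyMeasurable
      (fun t => ∑ n ∈ Finset.range B, c n * g (t - Real.log n)) volume := fun B =>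
    (memLp_finsetSum _ fun n _ => (hm n).const_mul (c n)).1
  have hfin : ENNReal.ofReal (∑' n, ‖c n‖) * eLpNorm g q < ⊤ :=
    ENNReal.mul_lt_top ENNReal.ofReal_lt_top hgq.2
  refine ((Lp.eLpNorm_lim_le_liminf_eLpNorm hSm _ hlim).trans ?_).trans_lt hfin
  exact (liminf_le_liminf (.of_forall hbound)).trans_eq (liminf_const _)

theorem laplace_eq_integral (hg : ∀ t ≤ 0, g t = 0) (s : ℂ) :
    laplace g s = ∫ t : ℝ, Complex.exp (-s * t) * g t :=
  setIntegral_eq_integral_of_forall_compl_eq_zero fun t ht => by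
    rw [hg t (by simpa using ht), mul_zero]

/-- A delay by `log n` multiplies the transform by `e^{-s log n}`, of modulus at most `1`;
summability of `‖c n‖` then permits exchanging sum and integral. -/
theorem laplace_logShiftSum (hc : Summable fun n => ‖c n‖) (hg : ∀ t ≤ 0, g t = 0) {s : ℂ}
    (hs : 0 < s.re) (hgi : Integrable fun t : ℝ => Complex.exp (-s * t) * g t) :
    laplace (logShiftSum c g) s = (∑' n : ℕ, c n * Complex.exp (-s * Real.log n)) * laplace g s := by
  set F : ℕ → ℝ → ℂ := fun n t => Complex.exp (-s * t) * (c n * g (t - Real.log n)) with hF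
  have hFn : ∀ n, F n = fun t => (c n * Complex.exp (-s * Real.log n)) *
      (fun t : ℝ => Complex.exp (-s * t) * g t) (t - Real.log n) := by
    intro n
    funext t
    simp only [hF]
    have : Complex.exp (-s * t) = Complex.exp (-s * Real.log n) *
        Complex.exp (-s * ((t - Real.log n : ℝ) : ℂ)) := by
      rw [← Complex.exp_add]; congr 1; push_cast; ring
    rw [this]; ring
  have hint : ∀ n, Integrable (F n) := fun n => by
    rw [hFn]
    exact (hgi.comp_sub_right _).const_mul _
  have hval : ∀ n, ∫ t, F n t = (c n * Complex.exp (-s * Real.log n)) * laplace g s := fun n => by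
    rw [hFn, integral_const_mul, integral_sub_right_eq_self
      (fun t : ℝ => Complex.exp (-s * t) * g t) (Real.log n), ← laplace_eq_integral hg]
  have hsum : Summable fun n => ∫ t, ‖F n t‖ := by
    refine Summable.of_nonneg_of_le (fun n => integral_nonneg fun _ => norm_nonneg _) (fun n => ?_)
      (hc.mul_right (∫ t : ℝ, ‖Complex.exp (-s * t) * g t‖))
    simp only [hFn, norm_mul (c n * _) _]
    rw [integral_const_mul, integral_sub_right_eq_self
      (fun t : ℝ => ‖Complex.exp (-s * t) * g t‖) (Real.log n), norm_mul]
    gcongr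
    refine mul_le_of_le_one_right (norm_nonneg _) ?_
    rw [Complex.norm_exp, Real.exp_le_one_iff]
    have := Real.log_natCast_nonneg n
    simp only [Complex.mul_re, Complex.neg_re, Complex.ofReal_re, Complex.ofReal_im, mul_zero,
      sub_zero]
    nlinarith
  rw [laplace_eq_integral (fun t ht => logShiftSum_of_nonpos hg ht), ← tsum_mul_right]
  simp only [← hval]
  rw [integral_tsum_of_summable_integral_norm hint hsum]
  refine integral_congr_ae (.of_forall fun t => ?_)
  simp only [logShiftSum, hF, tsum_mul_left]

end logShiftSum

/-! ### The reciprocal of the shifted zeta function -/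

/-- The coefficients of the Dirichlet series of `1 / ζ_h`. -/
noncomputable def moebiusCoeff (h : ℝ) (n : ℕ) : ℂ :=
  (ArithmeticFunction.moebius n : ℂ) * ((n : ℝ) ^ (-h) : ℝ)

theorem summable_norm_moebiusCoeff {h : ℝ} (hh : 1 < h) : Summable fun n => ‖moebiusCoeff h n‖ := by
  refine Summable.of_nonneg_of_le (fun _ => norm_nonneg _) (fun n => ?_)
    (Real.summable_nat_rpow.2 (by linarith : -h < -1))
  have h1 : ‖(ArithmeticFunction.moebius n : ℂ)‖ ≤ 1 := by
    rw [Complex.norm_intCast]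
    exact_mod_cast ArithmeticFunction.abs_moebius_le_one
  rw [moebiusCoeff, norm_mul, Complex.norm_real, Real.norm_of_nonneg (by positivity)]
  exact mul_le_of_le_one_left (by positivity) h1

theorem zetaShift_ne_zero {h : ℝ} (hh : 1 < h) {s : ℂ} (hs : 0 < s.re) : zetaShift h s ≠ 0 :=
  riemannZeta_ne_zero_of_one_lt_re (by simp; linarith)

theorem tsum_moebiusCoeff {h : ℝ} (hh : 1 < h) {s : ℂ} (hs : 0 < s.re) :
    ∑' n : ℕ, moebiusCoeff h n * Complex.exp (-s * Real.log n) = (zetaShift h s)⁻¹ := by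
  have h1 : 1 < (s + h).re := by simp; linarith
  have h2 := LSeries_one_mul_Lseries_moebius h1
  rw [LSeries_one_eq_riemannZeta h1] at h2
  rw [zetaShift, ← eq_inv_of_mul_eq_one_right h2, LSeries]
  refine tsum_congr fun n => ?_
  -- Here `e^{-s log 0} = 1`, but `μ(0) = 0` removes the spurious term.
  rcases eq_or_ne n 0 with rfl | hn
  · simp [moebiusCoeff]
  have hn0 : (n : ℂ) ≠ 0 := Nat.cast_ne_zero.2 hn
  rw [LSeries.term_of_ne_zero hn, moebiusCoeff, Complex.ofReal_cpow (Nat.cast_nonneg n),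
    Complex.ofReal_natCast, Complex.cpow_def_of_ne_zero hn0, Complex.cpow_def_of_ne_zero hn0,
    Complex.ofReal_log (Nat.cast_nonneg n), Complex.ofReal_natCast, mul_assoc, ← Complex.exp_add,
    div_eq_mul_inv, ← Complex.exp_neg]
  congr 2
  push_cast
  ring

/-- A bound uniform in `s`, so that division by `ζ_h` preserves `H^p`. -/
theorem norm_zetaShift_inv_le {h : ℝ} (hh : 1 < h) {s : ℂ} (hs : 0 < s.re) :
    ‖(zetaShift h s)⁻¹‖ ≤ ∑' n, ‖moebiusCoeff h n‖ := by
  rw [← tsum_moebiusCoeff hh hs]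
  have hle : ∀ n : ℕ, ‖moebiusCoeff h n * Complex.exp (-s * Real.log n)‖ ≤ ‖moebiusCoeff h n‖ := by
    intro n
    rw [norm_mul]
    refine mul_le_of_le_one_right (norm_nonneg _) ?_
    rw [Complex.norm_exp, Real.exp_le_one_iff]
    have := Real.log_natCast_nonneg n
    simp only [Complex.mul_re, Complex.neg_re, Complex.ofReal_re, Complex.ofReal_im, mul_zero,
      sub_zero]
    nlinarith
  have hs1 := summable_norm_moebiusCoeff hh
  have hs2 := Summable.of_nonneg_of_le (fun _ => norm_nonneg _) hle hs1
  exact (norm_tsum_le_tsum_norm hs2).trans (hs2.tsum_le_tsum hle hs1)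

theorem analyticOnNhd_zetaShift {h : ℝ} (hh : 1 < h) :
    AnalyticOnNhd ℂ (zetaShift h) rightHalfPlane := by
  have hopen := isOpen_rightHalfPlane
  refine DifferentiableOn.analyticOnNhd (fun s hs => ?_) hopen
  have hs' : 0 < s.re := hs
  have h1 : s + (h : ℂ) ≠ 1 := fun he => by
    have := congrArg Complex.re he
    simp at this
    linarith
  exact ((differentiableAt_riemannZeta h1).comp s
    (differentiableAt_id.add_const (h : ℂ))).differentiableWithinAt

/-! ### Hardy space membership -/

theorem ofReal_add_mul_I_mem_rightHalfPlane {x : ℝ} (hx : 0 < x) (y : ℝ) :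
    (x : ℂ) + (y : ℂ) * Complex.I ∈ rightHalfPlane := by
  simpa [rightHalfPlane] using hx

theorem continuous_comp_vertical {F : ℂ → ℂ} (hF : AnalyticOnNhd ℂ F rightHalfPlane) {x : ℝ}
    (hx : 0 < x) : Continuous fun y : ℝ => F ((x : ℂ) + (y : ℂ) * Complex.I) :=
  hF.continuousOn.comp_continuous (by fun_prop) (ofReal_add_mul_I_mem_rightHalfPlane hx)

theorem MemHardy.congr {p : ℝ} {F G : ℂ → ℂ} (hF : MemHardy p F) (h : EqOn F G rightHalfPlane) :
    MemHardy p G := by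
  obtain ⟨ha, C, hC, hb⟩ := hF
  refine ⟨ha.congr isOpen_rightHalfPlane h, C, hC, fun x hx => ?_⟩
  refine le_of_eq_of_le (congrArg (eLpNorm · _ _) (funext fun y => ?_)) (hb x hx)
  exact (h (ofReal_add_mul_I_mem_rightHalfPlane hx y)).symm

theorem MemHardy.add {p : ℝ} (hp : 1 ≤ p) {F G : ℂ → ℂ} (hF : MemHardy p F) (hG : MemHardy p G) :
    MemHardy p (fun s => F s + G s) := by
  obtain ⟨ha, C, hC, hb⟩ := hF
  obtain ⟨ha', C', hC', hb'⟩ := hG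
  refine ⟨ha.add ha', C + C', ENNReal.add_ne_top.2 ⟨hC, hC'⟩, fun x hx => ?_⟩
  exact (eLpNorm_add_le (continuous_comp_vertical ha hx).aestronglyMeasurable
    (continuous_comp_vertical ha' hx).aestronglyMeasurable (by simpa using hp)).trans
    (add_le_add (hb x hx) (hb' x hx))

theorem MemHardy.bounded_mul {p : ℝ} {F G : ℂ → ℂ} (hF : MemHardy p F)
    (hG : AnalyticOnNhd ℂ G rightHalfPlane) {B : ℝ} (hB : ∀ s ∈ rightHalfPlane, ‖G s‖ ≤ B) :
    MemHardy p (fun s => G s * F s) := by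
  obtain ⟨ha, C, hC, hb⟩ := hF
  refine ⟨hG.mul ha, ENNReal.ofReal B * C, ENNReal.mul_ne_top ENNReal.ofReal_ne_top hC,
    fun x hx => ?_⟩
  refine (eLpNorm_le_mul_eLpNorm_of_ae_le_mul (c := B) (.of_forall fun y => ?_) _).trans
    (mul_le_mul_right (hb x hx) _)
  rw [norm_mul]
  exact mul_le_mul_of_nonneg_right (hB _ (ofReal_add_mul_I_mem_rightHalfPlane hx y)) (norm_nonneg _)

theorem MemHardy.of_norm_le {p : ℝ} {F : ℂ → ℂ} (hF : AnalyticOnNhd ℂ F rightHalfPlane)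
    {g : ℝ → ℝ} (hg : MemLp g (ENNReal.ofReal p))
    (hb : ∀ x : ℝ, 0 < x → ∀ y : ℝ, ‖F ((x : ℂ) + (y : ℂ) * Complex.I)‖ ≤ g y) : MemHardy p F :=
  ⟨hF, _, hg.2.ne, fun x hx => eLpNorm_mono_real (hb x hx)⟩

theorem memLp_one_add_abs_sub_inv {p : ℝ} (hp : 1 < p) (v : ℝ) :
    MemLp (fun y : ℝ => (1 + |y - v|)⁻¹) (ENNReal.ofReal p) := by
  have hm : AEStronglyMeasurable (fun y : ℝ => (1 + |y - v|)⁻¹) volume :=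
    (Measurable.inv (by fun_prop)).aestronglyMeasurable
  rw [← integrable_norm_rpow_iff hm (by simp; linarith) ENNReal.ofReal_ne_top,
    ENNReal.toReal_ofReal (by linarith)]
  have h1 := (integrable_one_add_norm (E := ℝ) (μ := volume) (r := p)
    (by simpa using hp)).comp_sub_right v
  refine h1.congr (.of_forall fun y => ?_)
  have hpos : 0 ≤ 1 + |y - v| := by positivity
  simp only [Real.norm_eq_abs]
  rw [abs_of_nonneg (inv_nonneg.2 hpos), Real.inv_rpow hpos, Real.rpow_neg hpos]

/-- The poles keep a positive distance from the half-plane, so each term is dominated, uniformly in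
`x`, by a multiple of `(1 + |y - Im ω_i|)⁻¹`, which lies in `L^p` because `p > 1`. -/
theorem memHardy_expPolyLaplace {p : ℝ} (hp : 1 < p) {N : ℕ} {ω : Fin N → ℂ}
    (hω : ∀ i, (ω i).re < 0) {r : Fin N → ℕ} (a : (Σ i, Fin (r i)) → ℂ) :
    MemHardy p (expPolyLaplace ω a) := by
  have hne : ∀ s ∈ rightHalfPlane, s ∉ range ω := by
    rintro s hs ⟨i, rfl⟩
    exact lt_asymm hs (hω i)
  have key : ∀ i, ∃ c : ℝ, 0 < c ∧ c ≤ 1 ∧ ∀ x : ℝ, 0 < x → ∀ y : ℝ,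
      c * (1 + |y - (ω i).im|) ≤ ‖(x : ℂ) + (y : ℂ) * Complex.I - ω i‖ := by
    intro i
    have hi := hω i
    -- The half comes from averaging the lower bounds given by the real and imaginary parts.
    refine ⟨min (-(ω i).re) 1 / 2, by have := lt_min (neg_pos.2 hi) one_pos; positivity, by
      have := min_le_right (-(ω i).re) 1; linarith, fun x hx y => ?_⟩
    have h1 := Complex.abs_re_le_norm ((x : ℂ) + (y : ℂ) * Complex.I - ω i)
    have h2 := Complex.abs_im_le_norm ((x : ℂ) + (y : ℂ) * Complex.I - ω i)
    simp only [Complex.sub_re, Complex.add_re, Complex.ofReal_re, Complex.mul_re, Complex.I_re,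
      mul_zero, Complex.ofReal_im, Complex.I_im, mul_one, sub_zero, add_zero, Complex.sub_im,
      Complex.add_im, Complex.mul_im, zero_add] at h1 h2
    have h3 := le_abs_self (x - (ω i).re)
    have h4 := min_le_left (-(ω i).re) 1
    have h5 := min_le_right (-(ω i).re) 1
    have h6 := mul_le_mul_of_nonneg_right h5 (abs_nonneg (y - (ω i).im))
    linarith
  choose c hc0 hc1 hc using key
  refine MemHardy.of_norm_le (fun s hs => analyticAt_expPolyLaplace a (hne s hs))
    (g := fun y => ∑ x : (Σ i, Fin (r i)), (‖a x‖ * ((x.2 : ℕ).factorial *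
      ((c x.1)⁻¹ ^ ((x.2 : ℕ) + 1)))) * (1 + |y - (ω x.1).im|)⁻¹)
    (memLp_finsetSum _ fun x _ => (memLp_one_add_abs_sub_inv hp _).const_mul _)
    fun x hx y => ?_
  rw [expPolyLaplace]
  refine (norm_sum_le _ _).trans (Finset.sum_le_sum fun k _ => ?_)
  rw [norm_mul, norm_div, norm_pow, Complex.norm_natCast, mul_assoc, mul_assoc, div_eq_mul_inv]
  gcongr
  have h1 := hc k.1 x hx y
  have h2 := hc0 k.1
  have h3 : 1 ≤ 1 + |y - (ω k.1).im| := by linarith [abs_nonneg (y - (ω k.1).im)]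
  rw [← inv_pow]
  calc ‖(x : ℂ) + (y : ℂ) * Complex.I - ω k.1‖⁻¹ ^ ((k.2 : ℕ) + 1)
      ≤ (c k.1 * (1 + |y - (ω k.1).im|))⁻¹ ^ ((k.2 : ℕ) + 1) := by gcongr
    _ = (c k.1)⁻¹ ^ ((k.2 : ℕ) + 1) * ((1 + |y - (ω k.1).im|)⁻¹ ^ ((k.2 : ℕ) + 1)) := by
        rw [mul_inv, mul_pow]
    _ ≤ _ := by
        gcongr
        exact pow_le_of_le_one (by positivity) (inv_le_one_of_one_le₀ h3) (by omega)

/-! ### Initial values, solutions and the main theorem -/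

/-- Brings all moments up to `M` onto one vertical line: continuity handles `|y| ≤ 1`, and `|y|^n ≤
|y|^M` the rest. -/
theorem integrable_pow_mul_of_le {F : ℝ → ℂ} (hF : Continuous F) {n M : ℕ} (hn : n ≤ M)
    (hM : Integrable fun y : ℝ => (y : ℂ) ^ M * F y) : Integrable fun y : ℝ => (y : ℂ) ^ n * F y := by
  have hc : Continuous fun y : ℝ => (y : ℂ) ^ n * F y := by fun_prop
  have h1 : Integrable ((Icc (-1 : ℝ) 1).indicator fun y : ℝ => (y : ℂ) ^ n * F y) :=
    (hc.continuousOn.integrableOn_compact isCompact_Icc).integrable_indicator measurableSet_Icc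
  refine (h1.norm.add hM.norm).mono' hc.aestronglyMeasurable (.of_forall fun y => ?_)
  by_cases hy : y ∈ Icc (-1 : ℝ) 1
  · simp only [Pi.add_apply, indicator_of_mem hy]
    exact le_add_of_nonneg_right (norm_nonneg _)
  · have h2 : 1 ≤ |y| := by
      by_contra hlt
      exact hy (abs_le.1 (not_le.1 hlt).le)
    simp only [Pi.add_apply, indicator_of_notMem hy, norm_zero, zero_add, norm_mul, norm_pow,
      Complex.norm_real, Real.norm_eq_abs]
    gcongr

theorem iteratedDeriv_zero_of_eqOn_Iic {g : ℝ → ℂ} {n : ℕ} (hg : ContDiff ℝ n g)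
    (h0 : ∀ t ≤ 0, g t = 0) : iteratedDeriv n g 0 = 0 := by
  have hc : Continuous (iteratedDeriv n g) := hg.continuous_iteratedDeriv n le_rfl
  have h1 : EqOn (iteratedDeriv n g) 0 (Iio 0) := fun t ht => by
    have : g =ᶠ[nhds t] fun _ => 0 := by
      filter_upwards [Iio_mem_nhds ht] with x hx using h0 x (le_of_lt hx)
    rw [this.iteratedDeriv_eq n]
    simp [iteratedDeriv_fun_const_zero]
  have h2 := h1.closure hc continuous_const
  rw [closure_Iio] at h2
  exact h2 (by simp)

theorem laplace_congr_ae {f g : ℝ → ℂ} (h : f =ᵐ[volume.restrict (Ioi (0 : ℝ))] g) :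
    laplace f = laplace g := by
  funext s
  refine integral_congr_ae ?_
  filter_upwards [h] with t ht
  rw [ht]

theorem laplace_add {p p' : ℝ} (hpp' : p.HolderConjugate p') {f g : ℝ → ℂ}
    (hf : MemLpHalfLine p' f) (hg : MemLpHalfLine p' g) {s : ℂ} (hs : 0 < s.re) :
    laplace (fun t => f t + g t) s = laplace f s + laplace g s := by
  simp only [laplace, mul_add]
  exact integral_add (hf.integrableOn_exp_mul hpp' hs) (hg.integrableOn_exp_mul hpp' hs)

theorem IsSolution.laplace_eqOn {p p' h : ℝ} (hh : 1 < h) {J : ℝ → ℂ} {r₀ : ℂ → ℂ} {φ : ℝ → ℂ}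
    (hφ : IsSolution p p' (zetaShift h) J r₀ φ) :
    EqOn (laplace φ) (fun s => (laplace J s + r₀ s) / zetaShift h s) rightHalfPlane := by
  intro s hs
  have h1 : laplace J s = zetaShift h s * laplace φ s - r₀ s := hφ.eq_J.2 hs
  have h2 := zetaShift_ne_zero hh hs
  simp only [h1, sub_add_cancel]
  field_simp

/-- All derivatives of `f` up to order `K` vanish at `0` by continuity from the left, so only the
exponential polynomial is seen. Both summands are `C^K` across `0`, so one-sided and two-sided
derivatives agree. -/
theorem hasInitialValues_add_expPoly_iff {N : ℕ} (ω : Fin N → ℂ) {r : Fin N → ℕ} {f : ℝ → ℂ}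
    (hf : ContDiff ℝ (∑ i, r i : ℕ) f) (hf0 : ∀ t ≤ 0, f t = 0) (a : (Σ i, Fin (r i)) → ℂ)
    (φ₀ : Fin (∑ i, r i) → ℂ) :
    HasInitialValues φ₀ (fun t => f t + expPoly ω a t) ↔ expPolyInit ω r a = φ₀ := by
  have key : ∀ n : Fin (∑ i, r i),
      iteratedDerivWithin n (fun t => f t + expPoly ω a t) (Ici 0) 0 = expPolyInit ω r a n := by
    intro n
    have hfn : ContDiff ℝ (n : ℕ) f := hf.of_le (by exact_mod_cast n.2.le)
    have hen : ContDiff ℝ (n : ℕ) (expPoly ω a) := contDiff_expPoly ω a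
    rw [iteratedDerivWithin_eq_iteratedDeriv (uniqueDiffOn_Ici 0) (hfn.add hen).contDiffAt
      self_mem_Ici, iteratedDeriv_fun_add hfn.contDiffAt hen.contDiffAt,
      iteratedDeriv_zero_of_eqOn_Iic hfn hf0, zero_add, iteratedDeriv_expPoly_zero]
  exact ⟨fun H => funext fun n => (key n).symm.trans (H n), fun H n => (key n).trans (congrFun H n)⟩

/-- The inverse Laplace transform of `𝓛(J) / ζ_h` is of class `C ^ M` and vanishes to order `M`
at the origin. -/
theorem exists_invLaplace_div_zetaShift {h : ℝ} (hh : 1 < h) {p p' : ℝ}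
    (hpp' : p.HolderConjugate p') {J : ℝ → ℂ} (hJ : MemLpHalfLine p' J)
    (hLJ : AnalyticOnNhd ℂ (laplace J) rightHalfPlane) {M : ℕ} {σ : ℝ} (hσ : 0 < σ)
    (hH : Integrable (fun y : ℝ => (y : ℂ) ^ M * laplace J ((σ : ℂ) + (y : ℂ) * Complex.I))) :
    ∃ f : ℝ → ℂ, ContDiff ℝ M f ∧ (∀ t ≤ 0, f t = 0) ∧ MemLpHalfLine p' f ∧
      EqOn (laplace f) (fun s => laplace J s / zetaShift h s) rightHalfPlane := by
  obtain ⟨J', hJ'c, hJ'0, hJ'J⟩ := exists_contDiff_of_integrable_laplace hpp' hJ hσ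
    fun n hn => integrable_pow_mul_of_le (continuous_comp_vertical hLJ hσ) hn hH
  have hJ'p : MemLpHalfLine p' J' := (memLp_congr_ae hJ'J).2 hJ
  have hind : indicator (Ioi 0) J' = J' := by
    rw [indicator_eq_self]
    intro t ht
    by_contra hlt
    exact ht (hJ'0 t (not_lt.1 hlt))
  have hJ'v : MemLp J' (ENNReal.ofReal p') := by
    rw [← hind]
    exact (memLp_indicator_iff_restrict measurableSet_Ioi).2 hJ'p
  have hc := summable_norm_moebiusCoeff hh
  -- Division by `ζ_h` in the time domain: delays by `log n` with weights `μ(n) n^{-h}`.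
  refine ⟨logShiftSum (moebiusCoeff h) J', contDiff_logShiftSum hJ'0 hJ'c,
    fun t ht => logShiftSum_of_nonpos hJ'0 ht,
    (memLp_logShiftSum hc hJ'0 hJ'c.continuous
      (by simpa using hpp'.symm.lt.le) hJ'v).restrict _, fun s hs => ?_⟩
  have hint : Integrable fun t : ℝ => Complex.exp (-s * t) * J' t := by
    rw [← integrableOn_iff_integrable_of_support_subset (s := Ioi (0 : ℝ))]
    · exact hJ'p.integrableOn_exp_mul hpp' hs
    · intro t ht
      by_contra hlt
      exact ht (by simp [hJ'0 t (not_lt.1 hlt)])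
  rw [laplace_logShiftSum hc hJ'0 hs hint, tsum_moebiusCoeff hh hs, laplace_congr_ae hJ'J]
  exact inv_mul_eq_div _ _

/-- The generalized initial condition `ζ_h 𝓛(expPoly ω a)`. -/
theorem isGenInit_zetaShift_mul_expPolyLaplace {h : ℝ} (hh : 1 < h) {p : ℝ} (hp : 1 < p)
    {J : ℝ → ℂ} (hLJ : MemHardy p (laplace J)) {N : ℕ} {ω : Fin N → ℂ} (hω : ∀ i, (ω i).re < 0)
    (hω_inj : Function.Injective ω) {r : Fin N → ℕ} (hr : ∀ i, 0 < r i)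
    (a : (Σ i, Fin (r i)) → ℂ) :
    IsMeroExt ω (fun s => zetaShift h s * expPolyLaplace ω a s / zetaShift h s)
        (expPolyLaplace ω a) ∧
      IsGenInit p (zetaShift h) J ω r (fun s => zetaShift h s * expPolyLaplace ω a s) := by
  have hz : ∀ s ∈ rightHalfPlane, zetaShift h s ≠ 0 := fun s hs => zetaShift_ne_zero hh hs
  have hR := memHardy_expPolyLaplace hp hω a
  have hζ := analyticOnNhd_zetaShift hh
  have hdiv : EqOn (expPolyLaplace ω a)
      (fun s => zetaShift h s * expPolyLaplace ω a s / zetaShift h s) rightHalfPlane :=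
    fun s hs => (mul_div_cancel_left₀ _ (hz s hs)).symm
  have hext : IsMeroExt ω (fun s => zetaShift h s * expPolyLaplace ω a s / zetaShift h s)
      (expPolyLaplace ω a) :=
    ⟨hdiv, fun s hs => analyticAt_expPolyLaplace a hs, fun i => meromorphicAt_expPolyLaplace a _⟩
  refine ⟨hext, hζ.mul hR.1, hR.congr hdiv, ?_, expPolyLaplace ω a, hext,
    fun i => (le_meromorphicOrderAt_expPolyLaplace hω_inj a i (hr i)).1, ?_⟩
  · have h1 := hLJ.bounded_mul (G := fun s => (zetaShift h s)⁻¹) (hζ.inv hz)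
      fun s hs => norm_zetaShift_inv_le hh hs
    refine (h1.add hp.le hR).congr fun s hs => ?_
    have := hz s hs
    simp only
    field_simp
  · obtain ⟨C, hC⟩ := exists_norm_expPolyLaplace_le ω a
    refine ⟨C, 1, le_rfl, ?_⟩
    simpa only [Real.rpow_one] using hC

/-- Every generalized initial condition is of the form `ζ_h 𝓛(expPoly ω a)`. -/
theorem IsGenInit.exists_eqOn {h : ℝ} (hh : 1 < h) {p : ℝ} {J : ℝ → ℂ} {N : ℕ} {ω : Fin N → ℂ}
    (hω : ∀ i, (ω i).re < 0) (hω_inj : Function.Injective ω) {r : Fin N → ℕ} {r₁ : ℂ → ℂ}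
    (h₁ : IsGenInit p (zetaShift h) J ω r r₁) :
    ∃ a : (Σ i, Fin (r i)) → ℂ,
      EqOn r₁ (fun s => zetaShift h s * expPolyLaplace ω a s) rightHalfPlane := by
  obtain ⟨Q, hQ, hord, C, q, hq, hC⟩ := h₁.exists_ext
  have hlim : Filter.Tendsto Q (Bornology.cobounded ℂ) (nhds 0) := by
    refine squeeze_zero_norm' hC ?_
    exact ((tendsto_rpow_atTop (by linarith)).comp
      tendsto_norm_cobounded_atTop).const_div_atTop C
  obtain ⟨a, ha⟩ := exists_eq_expPolyLaplace hω_inj hQ.analyticAt hQ.meromorphicAt hord hlim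
  refine ⟨a, fun s hs => ?_⟩
  have hne : s ∉ range ω := by
    rintro ⟨i, rfl⟩
    exact lt_asymm hs (hω i)
  have h2 : r₁ s / zetaShift h s = expPolyLaplace ω a s := (hQ.eqOn hs).symm.trans (ha s hne)
  simp only [← h2]
  rw [mul_div_cancel₀ _ (zetaShift_ne_zero hh hs)]

theorem theorem4
    (h : ℝ) (hh : 1 < h)
    (p p' : ℝ) (hp1 : 1 < p) (hp2 : p ≤ 2) (hpp' : 1 / p + 1 / p' = 1)
    (J : ℝ → ℂ) (hJ : MemLpHalfLine p' J) (hLJ : MemHardy p (laplace J))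
    (N : ℕ) (ω : Fin N → ℂ) (hω : ∀ i, (ω i).re < 0) (hω_inj : Function.Injective ω)
    (r : Fin N → ℕ) (hr : ∀ i, 0 < r i)
    (M : ℕ) (hM : ∑ i, r i ≤ M)
    (hH : ∀ n : ℕ, n ≤ M → ∃ σ : ℝ, 0 < σ ∧
      Integrable (fun y : ℝ => (y : ℂ) ^ n * laplace J ((σ : ℂ) + (y : ℂ) * Complex.I))) :
    ∃ (ℓ : Fin N → ((Fin (∑ i, r i) → ℂ) →ₗ[ℂ] ℂ)) (c : Fin N → ℂ),
      (∀ i, ℓ i ≠ 0) ∧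
      ∀ φ₀ : Fin (∑ i, r i) → ℂ,
        ∃ (r₀ : ℂ → ℂ) (φ : ℝ → ℂ),
          -- existence of `r₀` and of a solution with the prescribed initial values
          IsGenInit p (zetaShift h) J ω r r₀ ∧
          IsSolution p p' (zetaShift h) J r₀ φ ∧
          IsInvLaplace p' (fun s => (laplace J s + r₀ s) / zetaShift h s) φ ∧
          ContDiffOn ℝ ((∑ i, r i : ℕ) : ℕ∞) φ (Ici (0 : ℝ)) ∧
          HasInitialValues φ₀ φ ∧
          -- `φ` is the only solution for this `r₀`
          (∀ ψ : ℝ → ℂ, IsSolution p p' (zetaShift h) J r₀ ψ →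
            ψ =ᵐ[volume.restrict (Ioi (0 : ℝ))] φ) ∧
          -- `r₀` is unique
          (∀ (r₁ : ℂ → ℂ) (ψ : ℝ → ℂ),
            IsGenInit p (zetaShift h) J ω r r₁ →
            IsSolution p p' (zetaShift h) J r₁ ψ →
            ContinuousOn ψ (Ici (0 : ℝ)) →
            HasInitialValues φ₀ ψ →
            EqOn r₁ r₀ rightHalfPlane) ∧
          -- off the hyperplanes `ℓ i = c i` the pole at `ω i` has order exactly `r i`
          (∀ Q : ℂ → ℂ, IsMeroExt ω (fun s => r₀ s / zetaShift h s) Q →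
            ∀ i, (meromorphicOrderAt Q (ω i) = ((-(r i : ℤ) : ℤ) : WithTop ℤ) ↔
              ℓ i φ₀ ≠ c i)) := by
  have hconj : p.HolderConjugate p' :=
    Real.holderConjugate_iff.2 ⟨hp1, by simpa only [one_div] using hpp'⟩
  obtain ⟨σ, hσ, hHσ⟩ := hH M le_rfl
  obtain ⟨f, hfc, hf0, hfp, hfL⟩ := exists_invLaplace_div_zetaShift hh hconj hJ hLJ.1 hσ hHσ
  have hfK : ContDiff ℝ (∑ i, r i : ℕ) f := hfc.of_le (by exact_mod_cast hM)
  set T := LinearEquiv.ofBijective (expPolyInit ω r) (expPolyInit_bijective hω_inj r) with hT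
  have hTapp : ∀ a, T a = expPolyInit ω r a := fun a => rfl
  have hep : ∀ a : (Σ i, Fin (r i)) → ℂ, MemLpHalfLine p' (expPoly ω a) := fun a =>
    memLpHalfLine_expPoly hω a hconj.symm.pos
  have hφp : ∀ a : (Σ i, Fin (r i)) → ℂ, MemLpHalfLine p' (fun t => f t + expPoly ω a t) :=
    fun a => MemLp.add hfp (hep a)
  have hφL : ∀ a : (Σ i, Fin (r i)) → ℂ, EqOn (laplace fun t => f t + expPoly ω a t)
      (fun s => (laplace J s + zetaShift h s * expPolyLaplace ω a s) / zetaShift h s)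
      rightHalfPlane := fun a s hs => by
    have hz := zetaShift_ne_zero hh hs
    rw [laplace_add hconj hfp (hep a) hs, hfL hs, laplace_expPoly hω a hs]
    field_simp
  -- `ℓ i` reads off the top coefficient at `ω i` of the exponential polynomial with initial values
  -- `φ₀`. The constants are `0` because `f` has zero initial values, so the hyperplanes pass
  -- through the origin.
  refine ⟨fun i => LinearMap.proj ⟨i, ⟨r i - 1, Nat.sub_lt (hr i) one_pos⟩⟩ ∘ₗ T.symm.toLinearMap,
    0, fun i hi => ?_, fun φ₀ => ?_⟩
  · have h1 := LinearMap.congr_fun hi (T fun _ => 1)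
    simp at h1
  set a := T.symm φ₀ with ha
  have hTa : expPolyInit ω r a = φ₀ := by rw [← hTapp, ha, T.apply_symm_apply]
  obtain ⟨hext, hgen⟩ := isGenInit_zetaShift_mul_expPolyLaplace hh hp1 hLJ hω hω_inj hr a
  have hres : EqOn (laplace J) (fun s => zetaShift h s * laplace (fun t => f t + expPoly ω a t) s -
      zetaShift h s * expPolyLaplace ω a s) rightHalfPlane := fun s hs => by
    have hz := zetaShift_ne_zero hh hs
    simp only [hφL a hs]
    field_simp
    ring
  refine ⟨fun s => zetaShift h s * expPolyLaplace ω a s, fun t => f t + expPoly ω a t, hgen,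
    ⟨hφp a, hLJ.congr hres, hJ, hres⟩, ⟨hφp a, hφL a⟩,
    (hfK.add (contDiff_expPoly ω a)).contDiffOn,
    (hasInitialValues_add_expPoly_iff ω hfK hf0 a φ₀).2 hTa, fun ψ hψ => ?_,
    fun r₁ ψ hr₁ hψ hψc hψ0 => ?_, fun Q hQ i => ?_⟩
  · exact ae_eq_of_laplace_eqOn hconj hψ.memLp (hφp a)
      ((hψ.laplace_eqOn hh).trans (hφL a).symm)
  · obtain ⟨b, hb⟩ := hr₁.exists_eqOn hh hω hω_inj
    have hae : ψ =ᵐ[volume.restrict (Ioi (0 : ℝ))] fun t => f t + expPoly ω b t := by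
      refine ae_eq_of_laplace_eqOn hconj hψ.memLp (hφp b) fun s hs => ?_
      rw [hψ.laplace_eqOn hh hs, hφL b hs]
      simp only [hb hs]
    -- Continuity turns a.e. equality into equality on all of `[0,∞)`, endpoint included, so the
    -- derivatives at `0` can be compared.
    have heq : EqOn ψ (fun t => f t + expPoly ω b t) (Ici 0) := by
      refine Measure.eqOn_of_ae_eq (μ := volume) ?_ hψc
        (hfc.continuous.add (contDiff_expPoly ω b (n := 0)).continuous).continuousOn
        (by rw [interior_Ici, closure_Ioi])
      rwa [← restrict_Ioi_eq_restrict_Ici]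
    have hb0 : expPolyInit ω r b = φ₀ :=
      (hasInitialValues_add_expPoly_iff ω hfK hf0 b φ₀).1 fun n => by
        rw [← hψ0 n]
        exact (iteratedDerivWithin_congr heq self_mem_Ici).symm
    rw [(expPolyInit_bijective hω_inj r).1 (hb0.trans hTa.symm)] at hb
    exact hb
  · rw [hQ.meromorphicOrderAt_eq hω hext,
      (le_meromorphicOrderAt_expPolyLaplace hω_inj a i (hr i)).2]
    rfl
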